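/- Let $n\ge 1$ and consider on $\mathbb{R}^n$, with Lebesgue measure $dx$, the vector fields $$Y_1=\frac{\partial}{\partial x_1},\qquad Y_i=\rho_i(x_1,\dots,x_{i-1})\frac{\partial}{\partial x_i},\quad i=2,\dots,n,$$ where each $\rho_i:\mathbb{R}^{i-1}\to\mathbb{R}$ is measurable and $\{\rho_i=0\}$ has Lebesgue measure zero in $\mathbb{R}^{i-1}$ (no smoothness or integrability of $\rho_i$ is assumed). Let $$\mathcal{L}=-\sum_{i=1}^n Y_i^2,\qquad \Gamma(f)=\sum_{i=1}^n (Y_if)^2,\qquad N(x)=\frac12\sum_{i=2}^n\ln\rho_i^2(x_1,\dots,x_{i-1}).$$ Derivatives are weak derivatives along lines: $Y_if=g$ means that on almost every line parallel to the $x_i$-axis $f$ and $g$ are locally integrable and $g$ is $\rho_i$ (a constant on that line; $1$ if $i=1$) times the one-dimensional weak derivative of $f$. The domain $\mathcal{D}(\Gamma)$ consists of the real-valued $f\in L^2(\mathbb{R}^n)$ for which all $Y_if$ exist and belong to $L^2(\mathbb{R}^n)$. Write $\|f\|_2^2=\int_{\mathbb{R}^n}f^2dx$, and read $f^2\ln(f^2/\|f\|_2^2)$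 as $0$ where $f=0$. Let $f\in\mathcal{D}(\Gamma)$, and suppose that the negative parts of $f^2\ln(f^2/\|f\|_2^2)$ and of $Nf^2$ are integrable. Then both of these functions are integrable, and for every $t>0$ $$\int_{\mathbb{R}^n} f^2\ln\frac{f^2}{\|f\|_2^2}\,dx\le t\int_{\mathbb{R}^n}\Gamma(f)\,dx-\frac n2\ln(\pi e^2t)\,\|f\|_2^2-\int_{\mathbb{R}^n}N f^2\,dx .$$ If moreover $\mathcal{L}f$ is defined, then $\mathcal{L}f\cdot f$ is integrable and for every $t>0$ $$\int_{\mathbb{R}^n} f^2\ln\frac{f^2}{\|f\|_2^2}\,dx\le t\int_{\mathbb{R}^n}\mathcal{L}f\cdot f\,dx-\frac n2\ln(\pi e^2t)\,\|f\|_2^2-\int_{\mathbb{R}^n}N f^2\,dx .$$ Here "$\mathcal{L}f$ is defined" means that one of the following holds: (a) all $Y_i(Y_if)$ exist in the weak sense above and all products $Y_i(Y_if)\cdot f$ are integrable, and $\mathcal{L}f=-\sum_iY_i(Y_if)$ almost everywhere; or (b) $f$ is in the domain of the operator associated with the quadratic form $\int\Gamma$, that is, $\mathcal{L}f\in L^2(\mathbb{R}^n)$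 and $\int\sum_iY_if\,Y_i\varphi\,dx=\int\mathcal{L}f\cdot\varphi\,dx$ for all $\varphi\in\mathcal{D}(\Gamma)$. -/

import Mathlib

open MeasureTheory
open scoped ContDiff

noncomputable section

namespace Grushin

/-- The coefficients of the vector fields `Y_i = coef ρ i * ∂_i` on `ℝⁿ` (coordinates indexed from
`0`): the first one is `1`, and the `i`-th one is the function `ρ i` of the coordinates that
precede `x i`. The value of `ρ` at the first index is not used. -/
def coef {n : ℕ} (ρ : (i : Fin n) → (Fin (i : ℕ) → ℝ) → ℝ) (i : Fin n) (x : Fin n → ℝ) : ℝ :=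
  if (i : ℕ) = 0 then 1 else ρ i (fun j => x ⟨j, j.isLt.trans i.isLt⟩)

/-- `Y_i f = g` in the weak sense. The field `Y_i` differentiates along the lines parallel to the
`i`-th axis only, and its coefficient is constant on each of them, so the derivative is taken
line by line: on almost every line, `g` is `coef ρ i` times the weak derivative of `f`. -/
def IsWeakY {n : ℕ} (ρ : (i : Fin n) → (Fin (i : ℕ) → ℝ) → ℝ) (i : Fin n)
    (f g : (Fin n → ℝ) → ℝ) : Prop :=
  ∀ᵐ x : Fin n → ℝ,
    LocallyIntegrable (fun u : ℝ => f (Function.update x i u)) ∧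
    LocallyIntegrable (fun u : ℝ => g (Function.update x i u)) ∧
    ∀ φ : ℝ → ℝ, ContDiff ℝ ∞ φ → HasCompactSupport φ →
      coef ρ i x * (∫ u, f (Function.update x i u) * deriv φ u)
        = - (∫ u, g (Function.update x i u) * φ u)

/-- `f` lies in the domain of the carré du champ `Γ f = ∑ (Y_i f)²`, that is, `f` and all the
`Y_i f` are in `L²(ℝⁿ)`, and `G i = Y_i f`. -/
def HasGradient {n : ℕ} (ρ : (i : Fin n) → (Fin (i : ℕ) → ℝ) → ℝ)
    (f : (Fin n → ℝ) → ℝ) (G : Fin n → (Fin n → ℝ) → ℝ) : Prop :=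
  MemLp f 2 ∧ ∀ i, MemLp (G i) 2 ∧ IsWeakY ρ i f (G i)

/-- `g = - ∑ Y_i (Y_i f)`, all derivatives in the weak sense, where `f` and the `Y_i f` are
square-integrable and the products `(Y_i (Y_i f)) * f` are integrable. -/
def IsNegSumSq {n : ℕ} (ρ : (i : Fin n) → (Fin (i : ℕ) → ℝ) → ℝ)
    (f g : (Fin n → ℝ) → ℝ) : Prop :=
  ∃ G K : Fin n → (Fin n → ℝ) → ℝ, HasGradient ρ f G ∧
    (∀ i, IsWeakY ρ i (G i) (K i) ∧ Integrable (fun x => K i x * f x)) ∧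
    ∀ᵐ x : Fin n → ℝ, g x = - ∑ i, K i x

/-- `f` is in the domain of the (self-adjoint) operator on `L²(ℝⁿ)` associated with the quadratic
form `∫ ∑ (Y_i f)²`, and `g` is its image. -/
def IsGenerator {n : ℕ} (ρ : (i : Fin n) → (Fin (i : ℕ) → ℝ) → ℝ)
    (f g : (Fin n → ℝ) → ℝ) : Prop :=
  MemLp g 2 ∧ ∃ G : Fin n → (Fin n → ℝ) → ℝ, HasGradient ρ f G ∧
    ∀ (φ : (Fin n → ℝ) → ℝ) (H : Fin n → (Fin n → ℝ) → ℝ), HasGradient ρ φ H →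
      (∫ x, ∑ i, G i x * H i x) = ∫ x, g x * φ x

/-- The square of the `L²` norm. -/
def normSq {n : ℕ} (f : (Fin n → ℝ) → ℝ) : ℝ := ∫ x, f x ^ 2

/-- The integrand `f² ln (f² / ‖f‖²)` (equal to `0` where `f = 0`). -/
def entDensity {n : ℕ} (f : (Fin n → ℝ) → ℝ) (x : Fin n → ℝ) : ℝ :=
  f x ^ 2 * Real.log (f x ^ 2 / normSq f)

/-- `N = (1/2) ∑ ln ρ_i²`; the first coefficient is `1` and contributes `0`. -/
def weightN {n : ℕ} (ρ : (i : Fin n) → (Fin (i : ℕ) → ℝ) → ℝ) (x : Fin n → ℝ) : ℝ :=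
  (1 / 2) * ∑ i, Real.log (coef ρ i x ^ 2)

end Grushin

end

/-!
The inequality is proved by triangular (Knothe) transport of the density `f²` to the standard
Gaussian. It is an inequality about `p = f²` alone: with `q_i = Y_i p = 2 f Y_i f` and
`r_i = (Y_i f)²` one has `q_i² ≤ 4 p r_i`, and these bounds survive integration over the last
coordinate, by the Cauchy–Schwarz inequality (`sq_marginal_le`, `IsWeakYInt.marginal`). Since the
coefficient of `Y_i` depends on the preceding coordinates only, the entropy can be split by the
chain rule into the entropies of the conditional densities of `x_i` given `x_1, …, x_{i-1}`, and on
each of the lines involved `Y_i` is a constant multiple `c` of the derivative (`exists_majorant`).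

On a line, let `T` be the monotone map that transports `p / m`, `m = ∫ p`, to the Gaussian density
`γ`, so that `p / m = γ(T) T'`. As `log (s T') ≤ s T' - 1`,
`log (p / m) ≤ log γ(T) + s T' - 1 - log s` (`log_density_le`). Here `∫ p T² = m` because `T`
transports `p / m` to `γ` (`integrable_mul_transport_sq`), and `s ∫ p T' = - s ∫ p' T` is bounded
by Young's inequality in terms of `∫ r` and `∫ p T²` (`integrable_mul_transportSlope`). The choice
`s = |c| √(t / 2)` gives the sharp constant, and `log |c|` is the contribution of the line to the
weight `N`.

All these bounds are kept in the form of an integrable majorant of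
`f² log (f² / ‖f‖²) + N f²`. Together with the integrable negative parts it yields the
integrability of both terms without any further discussion of infinite entropies. For the operator,
`∫ Γ(f) = ∫ L f · f` follows from the product rule on lines (`HasGradient.integral_mul_eq_neg`), or
by definition.
-/

namespace Grushin

open Set Filter Topology ProbabilityTheory

/-! ### Weak derivatives on the line -/

/-- `F` is a locally absolutely continuous function on the line whose derivative is the locally
integrable function `a`, expressed by the fundamental theorem of calculus. -/
def IsPrimitive (F a : ℝ → ℝ) : Prop :=
  LocallyIntegrable a ∧ ∀ x y, F y - F x = ∫ u in x..y, a u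

/-- `a` is the weak derivative of `f` on the line. -/
def IsWeakDeriv (f a : ℝ → ℝ) : Prop :=
  ∀ φ : ℝ → ℝ, ContDiff ℝ ∞ φ → HasCompactSupport φ → ∫ u, f u * deriv φ u = -∫ u, a u * φ u

namespace IsPrimitive

variable {F H a b : ℝ → ℝ}

lemma intervalIntegrable (h : IsPrimitive F a) (x y : ℝ) : IntervalIntegrable a volume x y :=
  (h.1.integrableOn_isCompact isCompact_uIcc).intervalIntegrable

lemma eq_add (h : IsPrimitive F a) (x : ℝ) : F = fun y => F x + ∫ u in x..y, a u := by
  funext y; rw [← h.2 x y]; ring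

lemma absolutelyContinuous (h : IsPrimitive F a) (x y : ℝ) :
    AbsolutelyContinuousOnInterval F x y := by
  have h1 := (h.intervalIntegrable x y).absolutelyContinuousOnInterval_intervalIntegral
    (c := x) (by simp)
  have h2 : AbsolutelyContinuousOnInterval (fun _ : ℝ => F x) x y :=
    (LipschitzWith.const (F x)).lipschitzOnWith.absolutelyContinuousOnInterval
  rw [h.eq_add x]
  exact h2.fun_add h1

lemma continuous (h : IsPrimitive F a) : Continuous F := by
  rw [h.eq_add 0]
  exact continuous_const.add
    (intervalIntegral.continuous_primitive (fun x y => h.intervalIntegrable x y) 0)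

lemma ae_deriv_eq (h : IsPrimitive F a) : ∀ᵐ x, deriv F x = a x := by
  filter_upwards [_root_.LocallyIntegrable.ae_hasDerivAt_integral h.1] with x hx
  rw [h.eq_add 0]
  exact ((hx 0).const_add (F 0)).deriv

lemma mul (hF : IsPrimitive F a) (hH : IsPrimitive H b) :
    IsPrimitive (fun x => F x * H x) (fun x => a x * H x + F x * b x) := by
  refine ⟨(hF.1.mul_continuous hH.continuous).add (hH.1.continuous_mul hF.continuous), ?_⟩
  intro x y
  rw [← AbsolutelyContinuousOnInterval.integral_deriv_mul_eq_sub (hF.absolutelyContinuous x y)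
    (hH.absolutelyContinuous x y)]
  apply intervalIntegral.integral_congr_ae
  filter_upwards [hF.ae_deriv_eq, hH.ae_deriv_eq] with u h1 h2 _
  rw [h1, h2]

lemma of_contDiff {φ : ℝ → ℝ} (hφ : ContDiff ℝ ∞ φ) : IsPrimitive φ (deriv φ) := by
  have hc : Continuous (deriv φ) := hφ.continuous_deriv (by simp)
  refine ⟨hc.locallyIntegrable, fun x y => ?_⟩
  rw [intervalIntegral.integral_deriv_eq_sub
    (fun u _ => (hφ.differentiable (by simp)).differentiableAt) (hc.intervalIntegrable x y)]

lemma tendsto_atTop (h : IsPrimitive F a) (ha : Integrable a) (x : ℝ) :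
    Tendsto F atTop (𝓝 (F x + ∫ u in Ioi x, a u)) := by
  conv => enter [1]; rw [h.eq_add x]
  exact tendsto_const_nhds.add
    (intervalIntegral_tendsto_integral_Ioi x ha.integrableOn tendsto_id)

lemma tendsto_atBot (h : IsPrimitive F a) (ha : Integrable a) (x : ℝ) :
    Tendsto F atBot (𝓝 (F x - ∫ u in Iic x, a u)) := by
  conv => enter [1]; rw [h.eq_add x]
  have := (intervalIntegral_tendsto_integral_Iic x ha.integrableOn tendsto_id).neg
  refine (tendsto_const_nhds.add this).congr fun y => ?_
  simp [intervalIntegral.integral_symm x]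

/-- An integrable primitive of an integrable function vanishes at `+∞`. -/
lemma eq_neg_integral_Ioi (h : IsPrimitive F a) (hF : Integrable F) (ha : Integrable a) (x : ℝ) :
    F x = -∫ u in Ioi x, a u := by
  have : F x + ∫ u in Ioi x, a u = 0 := by
    refine IntegrableAtFilter.eq_zero_of_tendsto (hF.integrableAtFilter atTop) ?_
      (h.tendsto_atTop ha x)
    intro s hs
    obtain ⟨c, hc⟩ := mem_atTop_sets.1 hs
    rw [← top_le_iff, ← Real.volume_Ici (a := c)]
    exact measure_mono fun y hy => hc y hy
  linarith

/-- An integrable primitive of an integrable function vanishes at `-∞`. -/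
lemma eq_integral_Iic (h : IsPrimitive F a) (hF : Integrable F) (ha : Integrable a) (x : ℝ) :
    F x = ∫ u in Iic x, a u := by
  have : F x - ∫ u in Iic x, a u = 0 := by
    refine IntegrableAtFilter.eq_zero_of_tendsto (hF.integrableAtFilter atBot) ?_
      (h.tendsto_atBot ha x)
    intro s hs
    obtain ⟨c, hc⟩ := mem_atBot_sets.1 hs
    rw [← top_le_iff, ← Real.volume_Iic (a := c)]
    exact measure_mono fun y hy => hc y hy
  linarith

lemma integral_eq_zero (h : IsPrimitive F a) (hF : Integrable F) (ha : Integrable a) :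
    ∫ u, a u = 0 := by
  rw [← intervalIntegral.integral_Iic_add_Ioi (b := 0) ha.integrableOn ha.integrableOn]
  linarith [h.eq_neg_integral_Ioi hF ha 0, h.eq_integral_Iic hF ha 0]

lemma isWeakDeriv (h : IsPrimitive F a) : IsWeakDeriv F a := by
  intro φ hφ hs
  have hc : Continuous (deriv φ) := hφ.continuous_deriv (by simp)
  have hm := h.mul (of_contDiff hφ)
  have i1 : Integrable (fun u => a u * φ u) := by
    simpa [mul_comm] using h.1.integrable_smul_left_of_hasCompactSupport hφ.continuous hs
  have i2 : Integrable (fun u => F u * deriv φ u) :=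
    (h.continuous.mul hc).integrable_of_hasCompactSupport hs.deriv.mul_left
  have i3 : Integrable (fun u => F u * φ u) :=
    (h.continuous.mul hφ.continuous).integrable_of_hasCompactSupport hs.mul_left
  have := hm.integral_eq_zero i3 (i1.add i2)
  rw [integral_add i1 i2] at this
  linarith

end IsPrimitive

lemma isPrimitive_integral {a : ℝ → ℝ} (ha : LocallyIntegrable a) :
    IsPrimitive (fun x => ∫ u in (0 : ℝ)..x, a u) a := by
  have hi : ∀ x y, IntervalIntegrable a volume x y := fun x y =>
    (ha.integrableOn_isCompact isCompact_uIcc).intervalIntegrable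
  refine ⟨ha, fun x y => ?_⟩
  rw [intervalIntegral.integral_interval_sub_left (hi _ _) (hi _ _)]

/-- A locally integrable function with vanishing weak derivative is constant. A test function `ψ`
differs from a multiple of a fixed bump `χ` by the derivative of a test function. -/
lemma ae_eq_const_of_isWeakDeriv_zero {f : ℝ → ℝ} (hf : LocallyIntegrable f)
    (h : ∀ φ : ℝ → ℝ, ContDiff ℝ ∞ φ → HasCompactSupport φ → ∫ u, f u * deriv φ u = 0) :
    ∃ C, ∀ᵐ x, f x = C := by
  let χb : ContDiffBump (0 : ℝ) := ⟨1, 2, one_pos, one_lt_two⟩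
  let χ : ℝ → ℝ := χb.normed volume
  have hχ : ContDiff ℝ ∞ χ := χb.contDiff_normed
  have hχs : HasCompactSupport χ := χb.hasCompactSupport_normed
  have hχ1 : ∫ u, χ u = 1 := χb.integral_normed
  have hint : ∀ ψ : ℝ → ℝ, Continuous ψ → HasCompactSupport ψ →
      Integrable (fun u => f u * ψ u) := fun ψ hψ hs => by
    simpa [mul_comm] using hf.integrable_smul_left_of_hasCompactSupport hψ hs
  refine ⟨∫ u, f u * χ u, ?_⟩
  refine ae_eq_of_integral_contDiff_smul_eq hf (locallyIntegrable_const _) fun ψ hψ hs => ?_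
  let κ : ℝ → ℝ := fun u => ψ u - (∫ v, ψ v) * χ u
  have hκ : ContDiff ℝ ∞ κ := hψ.sub (contDiff_const.mul hχ)
  have hκs : HasCompactSupport κ := hs.sub hχs.mul_left
  have hκi : Integrable κ := hκ.continuous.integrable_of_hasCompactSupport hκs
  have hψi : Integrable ψ := hψ.continuous.integrable_of_hasCompactSupport hs
  have hχi : Integrable χ := hχ.continuous.integrable_of_hasCompactSupport hχs
  have hκ0 : ∫ u, κ u = 0 := by
    simp only [κ]
    rw [integral_sub hψi (hχi.const_mul _), integral_const_mul, hχ1]; ring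
  let φ : ℝ → ℝ := fun x => ∫ u in Iic x, κ u
  obtain ⟨R, hR⟩ := hκs.isCompact.isBounded.subset_closedBall 0
  have hκz : ∀ u, R < |u| → κ u = 0 := fun u hu => by
    by_contra hne
    have := hR (subset_tsupport _ hne)
    rw [mem_closedBall_zero_iff, Real.norm_eq_abs] at this
    linarith
  have hφd : ∀ x, HasDerivAt φ (κ x) x := by
    intro x
    have h1 : φ = fun y => φ 0 + ∫ u in (0 : ℝ)..y, κ u := by
      funext y
      rw [← intervalIntegral.integral_Iic_sub_Iic hκi.integrableOn hκi.integrableOn]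
      simp [φ]
    rw [h1]
    exact (hκ.continuous.integral_hasStrictDerivAt 0 x).hasDerivAt.const_add _
  have hφ' : deriv φ = κ := funext fun x => (hφd x).deriv
  have hφc : ContDiff ℝ ∞ φ := by
    rw [contDiff_infty_iff_deriv]
    exact ⟨fun x => (hφd x).differentiableAt, hφ' ▸ hκ⟩
  have hφs : HasCompactSupport φ := by
    refine HasCompactSupport.intro (isCompact_closedBall (0 : ℝ) R) fun x hx => ?_
    rw [mem_closedBall_zero_iff, Real.norm_eq_abs, not_le] at hx
    rcases lt_abs.1 hx with h1 | h1
    · have h2 : ∫ u in Ioi x, κ u = 0 := by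
        refine setIntegral_eq_zero_of_forall_eq_zero fun u hu => hκz u ?_
        exact lt_of_lt_of_le (h1.trans hu) (le_abs_self u)
      have h3 := intervalIntegral.integral_Iic_add_Ioi (b := x) hκi.integrableOn hκi.integrableOn
      simp only [φ]
      linarith
    · refine setIntegral_eq_zero_of_forall_eq_zero fun u hu => hκz u ?_
      have : u ≤ x := hu
      exact lt_of_lt_of_le (by linarith) (neg_le_abs u)
  have key := h φ hφc hφs
  rw [hφ'] at key
  simp only [κ, mul_sub] at key
  rw [integral_sub (hint ψ hψ.continuous hs)
    (by simpa [mul_left_comm] using (hint χ hχ.continuous hχs).const_mul (∫ v, ψ v))] at key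
  have e : ∀ u, f u * ((∫ v, ψ v) * χ u) = (∫ v, ψ v) * (f u * χ u) := fun u => by ring
  simp only [e, integral_const_mul] at key
  simp only [smul_eq_mul]
  rw [integral_mul_const]
  simp only [mul_comm (ψ _)]
  linarith

/-- A weakly differentiable function has a locally absolutely continuous representative. -/
lemma IsWeakDeriv.exists_isPrimitive {f a : ℝ → ℝ} (h : IsWeakDeriv f a)
    (hf : LocallyIntegrable f) (ha : LocallyIntegrable a) :
    ∃ F, IsPrimitive F a ∧ ∀ᵐ x, f x = F x := by
  have hA := isPrimitive_integral ha
  set A : ℝ → ℝ := fun x => ∫ u in (0 : ℝ)..x, a u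
  have hAl : LocallyIntegrable A := hA.continuous.locallyIntegrable
  obtain ⟨C, hC⟩ := ae_eq_const_of_isWeakDeriv_zero (hf.sub hAl) (by
    intro φ hφ hs
    have hc : Continuous (deriv φ) := hφ.continuous_deriv (by simp)
    have hi : ∀ g : ℝ → ℝ, LocallyIntegrable g → Integrable (fun u => g u * deriv φ u) :=
      fun g hg => by
        simpa [mul_comm] using hg.integrable_smul_left_of_hasCompactSupport hc hs.deriv
    simp only [Pi.sub_apply, sub_mul]
    rw [integral_sub (hi f hf) (hi A hAl), h φ hφ hs, hA.isWeakDeriv φ hφ hs, sub_self])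
  refine ⟨fun x => A x + C, ⟨ha, fun x y => ?_⟩, ?_⟩
  · rw [← hA.2 x y]; ring
  · filter_upwards [hC] with x hx
    rw [← hx]; simp

/-- The Leibniz rule, together with the integrability that it presupposes. -/
lemma IsWeakDeriv.mul {f g a b : ℝ → ℝ} (hfa : IsWeakDeriv f a) (hgb : IsWeakDeriv g b)
    (hf : LocallyIntegrable f) (ha : LocallyIntegrable a) (hg : LocallyIntegrable g)
    (hb : LocallyIntegrable b) :
    ∃ F, IsPrimitive F (fun x => a x * g x + f x * b x) ∧ ∀ᵐ x, f x * g x = F x := by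
  obtain ⟨F, hF, hfF⟩ := hfa.exists_isPrimitive hf ha
  obtain ⟨H, hH, hgH⟩ := hgb.exists_isPrimitive hg hb
  have hm := hF.mul hH
  have hae : (fun x => a x * H x + F x * b x) =ᵐ[volume] fun x => a x * g x + f x * b x := by
    filter_upwards [hfF, hgH] with x h1 h2
    rw [h1, h2]
  refine ⟨fun x => F x * H x, ⟨?_, fun x y => ?_⟩, ?_⟩
  · exact hm.1.congr hae
  · rw [hm.2 x y]
    exact intervalIntegral.integral_congr_ae (hae.mono fun u hu _ => hu)
  · filter_upwards [hfF, hgH] with x h1 h2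
    rw [h1, h2]

/-! ### The transport of a density on the line to the Gaussian -/

/-- The standard Gaussian density. -/
noncomputable def gaussDensity (y : ℝ) : ℝ := gaussianPDFReal 0 1 y

/-- The standard Gaussian distribution function. -/
noncomputable def gaussCdf (y : ℝ) : ℝ := cdf (gaussianReal 0 1) y

lemma gaussDensity_pos (y : ℝ) : 0 < gaussDensity y := gaussianPDFReal_pos 0 1 y one_ne_zero

lemma continuous_gaussDensity : Continuous gaussDensity := by
  unfold gaussDensity gaussianPDFReal
  fun_prop

lemma measurable_gaussDensity : Measurable gaussDensity := continuous_gaussDensity.measurable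

lemma log_gaussDensity (y : ℝ) :
    Real.log (gaussDensity y) = -y ^ 2 / 2 - 1 / 2 * Real.log (2 * Real.pi) := by
  have h2 : (0 : ℝ) < 2 * Real.pi := by positivity
  simp only [gaussDensity, gaussianPDFReal, NNReal.coe_one, mul_one, sub_zero]
  rw [Real.log_mul (by positivity) (Real.exp_pos _).ne', Real.log_exp, Real.log_inv,
    Real.log_sqrt h2.le]
  ring

lemma gaussCdf_eq (y : ℝ) : gaussCdf y = ∫ u in Iic y, gaussDensity u := by
  unfold gaussCdf gaussDensity
  rw [cdf_eq_real, measureReal_def, gaussianReal_apply_eq_integral 0 one_ne_zero,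
    ENNReal.toReal_ofReal]
  exact setIntegral_nonneg measurableSet_Iic fun u _ => gaussianPDFReal_nonneg 0 1 u

lemma hasStrictDerivAt_gaussCdf (y : ℝ) : HasStrictDerivAt gaussCdf (gaussDensity y) y := by
  have hi : Integrable gaussDensity := integrable_gaussianPDFReal 0 1
  have h1 : gaussCdf = fun y => gaussCdf 0 + ∫ u in (0 : ℝ)..y, gaussDensity u := by
    funext y
    rw [← intervalIntegral.integral_Iic_sub_Iic hi.integrableOn hi.integrableOn,
      gaussCdf_eq, gaussCdf_eq]
    ring
  rw [h1]
  exact (continuous_gaussDensity.integral_hasStrictDerivAt 0 y).const_add _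

lemma strictMono_gaussCdf : StrictMono gaussCdf :=
  strictMono_of_deriv_pos fun y => by
    rw [(hasStrictDerivAt_gaussCdf y).hasDerivAt.deriv]; exact gaussDensity_pos y

lemma continuous_gaussCdf : Continuous gaussCdf :=
  continuous_iff_continuousAt.2 fun y => (hasStrictDerivAt_gaussCdf y).hasDerivAt.continuousAt

lemma gaussCdf_mem_Ioo (y : ℝ) : gaussCdf y ∈ Ioo (0 : ℝ) 1 :=
  ⟨(cdf_nonneg _ (y - 1)).trans_lt (strictMono_gaussCdf (by linarith)),
    (strictMono_gaussCdf (show y < y + 1 by linarith)).trans_le (cdf_le_one _ _)⟩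

lemma measurableEmbedding_gaussCdf : MeasurableEmbedding gaussCdf :=
  continuous_gaussCdf.measurableEmbedding strictMono_gaussCdf.injective

/-- The Gaussian quantile function, the inverse of the distribution function on `(0, 1)`; its
values elsewhere play no role. -/
noncomputable def gaussQuantile : ℝ → ℝ := measurableEmbedding_gaussCdf.invFun

lemma measurable_gaussQuantile : Measurable gaussQuantile :=
  measurableEmbedding_gaussCdf.measurable_invFun

lemma gaussQuantile_gaussCdf (y : ℝ) : gaussQuantile (gaussCdf y) = y :=
  measurableEmbedding_gaussCdf.leftInverse_invFun y

lemma exists_gaussCdf_eq {u : ℝ} (hu : u ∈ Ioo (0 : ℝ) 1) : ∃ y, gaussCdf y = u :=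
  mem_range_of_exists_le_of_exists_ge continuous_gaussCdf
    (((tendsto_cdf_atBot (gaussianReal 0 1)).eventually_le_const hu.1).exists)
    (((tendsto_cdf_atTop (gaussianReal 0 1)).eventually_const_le hu.2).exists)

lemma gaussCdf_gaussQuantile {u : ℝ} (hu : u ∈ Ioo (0 : ℝ) 1) :
    gaussCdf (gaussQuantile u) = u := by
  obtain ⟨y, rfl⟩ := exists_gaussCdf_eq hu
  rw [gaussQuantile_gaussCdf]

lemma hasDerivAt_gaussQuantile {u : ℝ} (hu : u ∈ Ioo (0 : ℝ) 1) :
    HasDerivAt gaussQuantile (gaussDensity (gaussQuantile u))⁻¹ u := by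
  have h := (hasStrictDerivAt_gaussCdf (gaussQuantile u)).to_local_left_inverse
    (gaussDensity_pos _).ne' (Eventually.of_forall gaussQuantile_gaussCdf)
  rw [gaussCdf_gaussQuantile hu] at h
  exact h.hasDerivAt

lemma gaussQuantile_le_iff {u v : ℝ} (hu : u ∈ Ioo (0 : ℝ) 1) (hv : v ∈ Ioo (0 : ℝ) 1) :
    gaussQuantile u ≤ gaussQuantile v ↔ u ≤ v := by
  rw [← strictMono_gaussCdf.le_iff_le, gaussCdf_gaussQuantile hu, gaussCdf_gaussQuantile hv]

lemma integrable_sq_gaussianReal : Integrable (fun y : ℝ => y ^ 2) (gaussianReal 0 1) := by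
  simpa using (memLp_id_gaussianReal (μ := 0) (v := 1) 2).integrable_sq

lemma integral_sq_gaussianReal : ∫ y, y ^ 2 ∂(gaussianReal 0 1) = 1 := by
  have h := variance_id_gaussianReal (μ := 0) (v := 1)
  rw [variance_eq_integral measurable_id.aemeasurable] at h
  simpa using h

/-- The normalised distribution function of a density `p` on the line. -/
noncomputable def cdfOf (p : ℝ → ℝ) (x : ℝ) : ℝ := (∫ u in Iic x, p u) / ∫ u, p u

/-- The monotone map that transports the density `p / ∫ p` to the standard Gaussian. -/
noncomputable def transport (p : ℝ → ℝ) (x : ℝ) : ℝ := gaussQuantile (cdfOf p x)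

/-- The derivative of the transport map, as given by the Monge–Ampère (change of variables)
equation. -/
noncomputable def transportSlope (p : ℝ → ℝ) (x : ℝ) : ℝ :=
  p x / ((∫ u, p u) * gaussDensity (transport p x))

section Transport

variable {p : ℝ → ℝ}

lemma integral_Icc_pos (hc : Continuous p) (h0 : ∀ x, 0 ≤ p x) {x y z : ℝ} (hxy : x < y)
    (hz : z ∈ Icc x y) (hpz : 0 < p z) : 0 < ∫ u in x..y, p u :=
  intervalIntegral.integral_pos hxy hc.continuousOn (fun u _ => h0 u) ⟨z, hz, hpz⟩

lemma cdfOf_sub (hi : Integrable p) (x y : ℝ) :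
    cdfOf p y - cdfOf p x = (∫ u in x..y, p u) / ∫ u, p u := by
  unfold cdfOf
  rw [← sub_div, intervalIntegral.integral_Iic_sub_Iic hi.integrableOn hi.integrableOn]

lemma monotone_cdfOf (hi : Integrable p) (h0 : ∀ x, 0 ≤ p x) : Monotone (cdfOf p) := by
  intro x y hxy
  rw [← sub_nonneg, cdfOf_sub hi]
  exact div_nonneg (intervalIntegral.integral_nonneg hxy fun u _ => h0 u)
    (integral_nonneg h0)

lemma cdfOf_lt (hc : Continuous p) (hi : Integrable p) (h0 : ∀ x, 0 ≤ p x)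
    (hm : 0 < ∫ u, p u) {x y z : ℝ} (hxy : x < y) (hz : z ∈ Icc x y) (hpz : 0 < p z) :
    cdfOf p x < cdfOf p y := by
  rw [← sub_pos, cdfOf_sub hi]
  exact div_pos (integral_Icc_pos hc h0 hxy hz hpz) hm

lemma cdfOf_nonneg (h0 : ∀ x, 0 ≤ p x) (x : ℝ) : 0 ≤ cdfOf p x :=
  div_nonneg (setIntegral_nonneg measurableSet_Iic fun u _ => h0 u) (integral_nonneg h0)

lemma cdfOf_le_one (hi : Integrable p) (h0 : ∀ x, 0 ≤ p x) (x : ℝ) : cdfOf p x ≤ 1 :=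
  div_le_one_of_le₀ (setIntegral_le_integral hi (Eventually.of_forall h0)) (integral_nonneg h0)

lemma cdfOf_mem_Ioo (hc : Continuous p) (hi : Integrable p) (h0 : ∀ x, 0 ≤ p x)
    (hm : 0 < ∫ u, p u) {x : ℝ} (hx : 0 < p x) : cdfOf p x ∈ Ioo (0 : ℝ) 1 :=
  ⟨(cdfOf_nonneg h0 (x - 1)).trans_lt
      (cdfOf_lt hc hi h0 hm (by linarith) ⟨by linarith, le_rfl⟩ hx),
    (cdfOf_lt hc hi h0 hm (show x < x + 1 by linarith) ⟨le_rfl, by linarith⟩ hx).trans_le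
      (cdfOf_le_one hi h0 _)⟩

lemma hasDerivAt_cdfOf (hc : Continuous p) (hi : Integrable p) (x : ℝ) :
    HasDerivAt (cdfOf p) (p x / ∫ u, p u) x := by
  have h1 : cdfOf p = fun y => cdfOf p 0 + (∫ u in (0 : ℝ)..y, p u) / ∫ u, p u := by
    funext y; rw [← cdfOf_sub hi]; ring
  rw [h1]
  exact (((hc.integral_hasStrictDerivAt 0 x).hasDerivAt).div_const _).const_add _

lemma hasDerivAt_transport (hc : Continuous p) (hi : Integrable p) {x : ℝ}
    (hx : cdfOf p x ∈ Ioo (0 : ℝ) 1) : HasDerivAt (transport p) (transportSlope p x) x := by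
  have h := (hasDerivAt_gaussQuantile hx).comp x (hasDerivAt_cdfOf hc hi x)
  have e : transportSlope p x =
      (gaussDensity (gaussQuantile (cdfOf p x)))⁻¹ * (p x / ∫ u, p u) := by
    rw [transportSlope, transport, div_eq_mul_inv, mul_inv]; ring
  rw [e]
  exact h

lemma measurable_transport (hi : Integrable p) (h0 : ∀ x, 0 ≤ p x) :
    Measurable (transport p) :=
  measurable_gaussQuantile.comp (monotone_cdfOf hi h0).measurable

lemma exists_cdfOf_eq (hc : Continuous p) (hi : Integrable p)
    (hm : 0 < ∫ u, p u) {v : ℝ} (hv : v ∈ Ioo (0 : ℝ) 1) : ∃ z, cdfOf p z = v := by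
  have hcont : Continuous (cdfOf p) :=
    continuous_iff_continuousAt.2 fun x => (hasDerivAt_cdfOf hc hi x).continuousAt
  have e : cdfOf p = fun y => cdfOf p 0 + (∫ u in (0 : ℝ)..y, p u) / ∫ u, p u := by
    funext y; rw [← cdfOf_sub hi]; ring
  have t1 : Tendsto (cdfOf p) atTop (𝓝 1) := by
    rw [e]
    have := (tendsto_const_nhds (x := cdfOf p 0)).add
      ((intervalIntegral_tendsto_integral_Ioi 0 hi.integrableOn tendsto_id).div_const
        (∫ u, p u))
    have e1 : cdfOf p 0 + (∫ u in Ioi 0, p u) / ∫ u, p u = 1 := by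
      rw [cdfOf, ← add_div, intervalIntegral.integral_Iic_add_Ioi hi.integrableOn
        hi.integrableOn, div_self hm.ne']
    rw [e1] at this
    exact this
  have t0 : Tendsto (cdfOf p) atBot (𝓝 0) := by
    rw [e]
    have := (tendsto_const_nhds (x := cdfOf p 0)).add
      (((intervalIntegral_tendsto_integral_Iic 0 hi.integrableOn tendsto_id).neg).div_const
        (∫ u, p u))
    have e1 : cdfOf p 0 + (-∫ u in Iic 0, p u) / ∫ u, p u = 0 := by
      rw [cdfOf]; ring
    rw [e1] at this
    refine this.congr fun y => ?_
    rw [intervalIntegral.integral_symm 0, id, neg_neg]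
  exact mem_range_of_exists_le_of_exists_ge hcont
    (t0.eventually_le_const hv.1).exists (t1.eventually_const_le hv.2).exists

/-- The transport map sends the probability density `p / ∫ p` to the standard Gaussian. -/
lemma map_transport (hc : Continuous p) (hi : Integrable p) (h0 : ∀ x, 0 ≤ p x)
    (hm : 0 < ∫ u, p u) :
    (volume.withDensity fun x => ENNReal.ofReal (p x / ∫ u, p u)).map (transport p)
      = gaussianReal 0 1 := by
  set m := ∫ u, p u
  set μ := volume.withDensity fun x => ENNReal.ofReal (p x / m)
  have hd : ∀ s : Set ℝ, MeasurableSet s → μ s = ENNReal.ofReal ((∫ u in s, p u) / m) := by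
    intro s hs
    rw [withDensity_apply _ hs, ← integral_div, ofReal_integral_eq_lintegral_ofReal]
    · exact (hi.div_const m).integrableOn
    · exact Eventually.of_forall fun x => div_nonneg (h0 x) hm.le
  have hprob : IsProbabilityMeasure μ := ⟨by
    rw [hd _ MeasurableSet.univ, setIntegral_univ, div_self hm.ne', ENNReal.ofReal_one]⟩
  have hT := measurable_transport hi h0
  have := Measure.isProbabilityMeasure_map (μ := μ) hT.aemeasurable
  have hpos : ∀ᵐ x ∂μ, 0 < p x := by
    rw [ae_withDensity_iff (by fun_prop)]
    refine Eventually.of_forall fun x hx => (h0 x).lt_of_ne' fun h => hx ?_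
    simp [h]
  refine Measure.ext_of_Iic _ _ fun y => ?_
  obtain ⟨z, hz⟩ := exists_cdfOf_eq hc hi hm (gaussCdf_mem_Ioo y)
  rw [Measure.map_apply hT measurableSet_Iic, ← ofReal_cdf]
  change _ = ENNReal.ofReal (gaussCdf y)
  rw [← hz, cdfOf, ← hd _ measurableSet_Iic]
  refine measure_congr (eventuallyEq_set.2 ?_)
  filter_upwards [hpos] with x hx
  simp only [mem_preimage, mem_Iic]
  have e : y = gaussQuantile (cdfOf p z) := by rw [hz, gaussQuantile_gaussCdf]
  rw [transport, e, gaussQuantile_le_iff (cdfOf_mem_Ioo hc hi h0 hm hx)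
    (hz ▸ gaussCdf_mem_Ioo y)]
  refine ⟨fun h => ?_, fun h => monotone_cdfOf hi h0 h⟩
  by_contra hlt
  exact absurd (cdfOf_lt hc hi h0 hm (not_le.1 hlt) ⟨(not_le.1 hlt).le, le_rfl⟩ hx) h.not_gt

lemma integrable_mul_transport_sq (hc : Continuous p) (hi : Integrable p) (h0 : ∀ x, 0 ≤ p x)
    (hm : 0 < ∫ u, p u) :
    Integrable (fun x => p x * transport p x ^ 2) ∧
      ∫ x, p x * transport p x ^ 2 = ∫ u, p u := by
  have hmap := map_transport hc hi h0 hm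
  set m := ∫ u, p u
  have hT := measurable_transport hi h0
  have h1 := integrable_sq_gaussianReal
  have h2 := integral_sq_gaussianReal
  have hq : ∀ x, 0 ≤ p x / m := fun x => div_nonneg (h0 x) hm.le
  rw [← hmap] at h1 h2
  rw [integrable_map_measure (by fun_prop) hT.aemeasurable,
    integrable_withDensity_iff_integrable_smul' (by fun_prop) (by simp)] at h1
  rw [integral_map hT.aemeasurable (by fun_prop),
    integral_withDensity_eq_integral_toReal_smul (by fun_prop) (by simp)] at h2
  have e : ∀ x, p x * transport p x ^ 2 =
      m * ((ENNReal.ofReal (p x / m)).toReal • transport p x ^ 2) := fun x => by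
    rw [ENNReal.toReal_ofReal (hq x), smul_eq_mul]; field_simp
  simp only [e]
  refine ⟨h1.const_mul m, ?_⟩
  rw [integral_const_mul, h2, mul_one]

end Transport

/-! ### The energy bound for the transport map -/

lemma transportSlope_nonneg {p : ℝ → ℝ} (h0 : ∀ x, 0 ≤ p x) (x : ℝ) : 0 ≤ transportSlope p x :=
  div_nonneg (h0 x) (mul_nonneg (integral_nonneg h0) (gaussDensity_pos _).le)

/-- Young's inequality for `q T`, where `q` is the derivative of the density `p`. -/
lemma abs_mul_le_of_sq_le {p q r T s t : ℝ} (hs : 0 < s) (ht : 0 < t)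
    (hr : 0 ≤ r) (h : q ^ 2 ≤ 4 * (p * r)) (hp : 0 ≤ p) :
    s * |q * T| ≤ t * r + s ^ 2 / t * (p * T ^ 2) := by
  have h1 : 0 ≤ t * r + s ^ 2 / t * (p * T ^ 2) := by positivity
  refine abs_le_of_sq_le_sq' ?_ h1 |>.2
  rw [mul_pow, sq_abs, mul_pow]
  have h2 : s ^ 2 * (q ^ 2 * T ^ 2) ≤ s ^ 2 * (4 * (p * r) * T ^ 2) := by gcongr
  have h3 : (t * r + s ^ 2 / t * (p * T ^ 2)) ^ 2 - s ^ 2 * (4 * (p * r) * T ^ 2)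
      = (t * r - s ^ 2 / t * (p * T ^ 2)) ^ 2 := by field_simp; ring
  nlinarith [sq_nonneg (t * r - s ^ 2 / t * (p * T ^ 2))]

/-- Integration by parts for `∫ p T'` over an interval on whose ends `T` has opposite signs. The
boundary terms cost nothing: they are dominated by the integrals of `|q T|` over the two rays
outside the interval. -/
lemma integral_mul_transportSlope_le {p q : ℝ → ℝ} (hp : IsPrimitive p q) (hi : Integrable p)
    (h0 : ∀ x, 0 ≤ p x) (hm : 0 < ∫ u, p u) (hq : Integrable q)
    (hq0 : ∀ᵐ x, p x = 0 → q x = 0) (hqT : Integrable fun x => q x * transport p x)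
    {α β : ℝ} (hαβ : α ≤ β) (hα : cdfOf p α ∈ Ioo (0 : ℝ) 1) (hβ : cdfOf p β ∈ Ioo (0 : ℝ) 1)
    (hTα : transport p α ≤ 0) (hTβ : 0 ≤ transport p β) :
    IntegrableOn (fun x => p x * transportSlope p x) (Ioc α β) ∧
    ∫ x in Ioc α β, p x * transportSlope p x ≤ ∫ x, |q x * transport p x| := by
  have hc := hp.continuous
  have hmono := monotone_cdfOf hi h0
  have hmem : ∀ x ∈ uIcc α β, cdfOf p x ∈ Ioo (0 : ℝ) 1 := fun x hx => by
    rw [uIcc_of_le hαβ] at hx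
    exact ⟨hα.1.trans_le (hmono hx.1), (hmono hx.2).trans_lt hβ.2⟩
  have hd : ∀ x ∈ uIcc α β, HasDerivAt (transport p) (transportSlope p x) x :=
    fun x hx => hasDerivAt_transport hc hi (hmem x hx)
  have hTc : ContinuousOn (transport p) (uIcc α β) :=
    fun x hx => (hd x hx).continuousAt.continuousWithinAt
  have hSc : ContinuousOn (transportSlope p) (uIcc α β) := by
    unfold transportSlope
    refine hc.continuousOn.div
      (continuousOn_const.mul (continuous_gaussDensity.comp_continuousOn hTc)) fun x _ => ?_
    exact (mul_pos hm (gaussDensity_pos _)).ne'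
  have hTac : AbsolutelyContinuousOnInterval (transport p) α β := by
    obtain ⟨C, hC⟩ := isCompact_uIcc.exists_bound_of_continuousOn hSc
    refine LipschitzOnWith.absolutelyContinuousOnInterval (K := C.toNNReal) ?_
    refine (convex_uIcc α β).lipschitzOnWith_of_nnnorm_hasDerivWithin_le
      (fun x hx => (hd x hx).hasDerivWithinAt) fun x hx => ?_
    rw [← NNReal.coe_le_coe, coe_nnnorm]
    exact (hC x hx).trans (Real.le_coe_toNNReal C)
  have hInt : IntegrableOn (fun x => p x * transportSlope p x) (Ioc α β) := by
    rw [← intervalIntegrable_iff_integrableOn_Ioc_of_le hαβ]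
    exact (hc.continuousOn.mul hSc).intervalIntegrable
  refine ⟨hInt, ?_⟩
  have ibp := (hp.absolutelyContinuous α β).integral_mul_deriv_eq_deriv_mul hTac
  have e1 : ∫ x in α..β, p x * deriv (transport p) x
      = ∫ x in Ioc α β, p x * transportSlope p x := by
    rw [← intervalIntegral.integral_of_le hαβ]
    exact intervalIntegral.integral_congr fun x hx => by simp only [(hd x hx).deriv]
  have e2 : ∫ x in α..β, deriv p x * transport p x
      = ∫ x in Ioc α β, q x * transport p x := by
    rw [← intervalIntegral.integral_of_le hαβ]
    refine intervalIntegral.integral_congr_ae ?_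
    filter_upwards [hp.ae_deriv_eq] with x hx _
    rw [hx]
  rw [e1, e2] at ibp
  have hA : Integrable fun x => |q x * transport p x| := hqT.abs
  have b1 : -∫ x in Ioc α β, q x * transport p x ≤ ∫ x in Ioc α β, |q x * transport p x| :=
    (neg_le_abs _).trans abs_integral_le_integral_abs
  -- The boundary terms are absorbed by the tails, since `|T|` is larger there.
  have b2 : p β * transport p β ≤ ∫ x in Ioi β, |q x * transport p x| := by
    have h1 : p β ≤ ∫ x in Ioi β, |q x| := by
      rw [hp.eq_neg_integral_Ioi hi hq β]
      exact (neg_le_abs _).trans abs_integral_le_integral_abs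
    refine (mul_le_mul_of_nonneg_right h1 hTβ).trans ?_
    rw [← integral_mul_const]
    refine setIntegral_mono_on_ae (hq.abs.mul_const _).integrableOn hA.integrableOn
      measurableSet_Ioi ?_
    filter_upwards [hq0] with x hx hxβ
    rcases (h0 x).eq_or_lt with h | h
    · simp [hx h.symm]
    · rw [abs_mul]
      refine mul_le_mul_of_nonneg_left ?_ (abs_nonneg _)
      refine le_trans ?_ (le_abs_self _)
      exact (gaussQuantile_le_iff hβ (cdfOf_mem_Ioo hc hi h0 hm h)).2 (hmono (le_of_lt hxβ))
  have b3 : -(p α * transport p α) ≤ ∫ x in Iic α, |q x * transport p x| := by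
    have h1 : p α ≤ ∫ x in Iic α, |q x| := by
      rw [hp.eq_integral_Iic hi hq α]
      exact (le_abs_self _).trans abs_integral_le_integral_abs
    rw [← mul_neg]
    refine (mul_le_mul_of_nonneg_right h1 (neg_nonneg.2 hTα)).trans ?_
    rw [← integral_mul_const]
    refine setIntegral_mono_on_ae (hq.abs.mul_const _).integrableOn hA.integrableOn
      measurableSet_Iic ?_
    filter_upwards [hq0] with x hx hxα
    rcases (h0 x).eq_or_lt with h | h
    · simp [hx h.symm]
    · rw [abs_mul]
      refine mul_le_mul_of_nonneg_left ?_ (abs_nonneg _)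
      refine le_trans (neg_le_neg ?_) (neg_le_abs _)
      exact (gaussQuantile_le_iff (cdfOf_mem_Ioo hc hi h0 hm h) hα).2 (hmono hxα)
  have e3 : ∫ x, |q x * transport p x| = (∫ x in Iic α, |q x * transport p x|)
      + (∫ x in Ioc α β, |q x * transport p x|) + ∫ x in Ioi β, |q x * transport p x| := by
    rw [← intervalIntegral.integral_Iic_add_Ioi (b := β) hA.integrableOn hA.integrableOn,
      ← intervalIntegral.integral_of_le hαβ,
      ← intervalIntegral.integral_Iic_sub_Iic hA.integrableOn hA.integrableOn]
    ring
  linarith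

/-- The part of the transport proof that uses the energy: integrating `p T'` by parts and applying
Young's inequality. -/
lemma integrable_mul_transportSlope {p q r : ℝ → ℝ} {s t : ℝ} (hp : IsPrimitive p q)
    (hi : Integrable p)
    (h0 : ∀ x, 0 ≤ p x) (hm : 0 < ∫ u, p u) (hq : Integrable q) (hr : Integrable r)
    (hr0 : ∀ᵐ x, 0 ≤ r x) (hqr : ∀ᵐ x, q x ^ 2 ≤ 4 * (p x * r x)) (hs : 0 < s) (ht : 0 < t) :
    Integrable (fun x => p x * transportSlope p x) ∧
      s * ∫ x, p x * transportSlope p x ≤ t * (∫ x, r x) + s ^ 2 / t * ∫ x, p x := by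
  have hc := hp.continuous
  obtain ⟨hT1, hT2⟩ := integrable_mul_transport_sq hc hi h0 hm
  have hTm := measurable_transport hi h0
  have hmaj : Integrable fun x => t * r x + s ^ 2 / t * (p x * transport p x ^ 2) :=
    (hr.const_mul t).add (hT1.const_mul _)
  have hle : ∀ᵐ x, s * |q x * transport p x| ≤
      t * r x + s ^ 2 / t * (p x * transport p x ^ 2) := by
    filter_upwards [hr0, hqr] with x h1 h2
    exact abs_mul_le_of_sq_le hs ht h1 h2 (h0 x)
  have hqT : Integrable fun x => q x * transport p x := by
    have : Integrable fun x => s * (q x * transport p x) := by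
      refine hmaj.mono' ((hq.aestronglyMeasurable.mul hTm.aestronglyMeasurable).const_mul s) ?_
      filter_upwards [hle] with x hx
      rwa [Real.norm_eq_abs, abs_mul, abs_of_pos hs]
    simpa [hs.ne'] using this.const_mul s⁻¹
  have hq0 : ∀ᵐ x, p x = 0 → q x = 0 := by
    filter_upwards [hqr] with x hx h
    rw [h] at hx
    exact (pow_eq_zero_iff two_ne_zero).1 (le_antisymm (by simpa using hx) (sq_nonneg (q x)))
  set D := ∫ x, |q x * transport p x|
  have hD : s * D ≤ t * (∫ x, r x) + s ^ 2 / t * ∫ x, p x := by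
    rw [← integral_const_mul, ← hT2, ← integral_const_mul, ← integral_const_mul,
      ← integral_add (hr.const_mul t) (hT1.const_mul _)]
    exact integral_mono_ae (hqT.abs.const_mul s) hmaj hle
  -- Exhaust `{p ≠ 0}` by the intervals between the Gaussian levels `-k` and `k`.
  choose α hα using fun k : ℕ => exists_cdfOf_eq hc hi hm (gaussCdf_mem_Ioo (-(k : ℝ)))
  choose β hβ using fun k : ℕ => exists_cdfOf_eq hc hi hm (gaussCdf_mem_Ioo (k : ℝ))
  have hmono := monotone_cdfOf hi h0
  have key : ∀ k : ℕ, IntegrableOn (fun x => p x * transportSlope p x) (Ioc (α k) (β k)) ∧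
      ∫ x in Ioc (α k) (β k), p x * transportSlope p x ≤ D := by
    intro k
    rcases le_or_gt (α k) (β k) with h | h
    · refine integral_mul_transportSlope_le hp hi h0 hm hq hq0 hqT h
        (hα k ▸ gaussCdf_mem_Ioo _) (hβ k ▸ gaussCdf_mem_Ioo _) ?_ ?_
      · rw [transport, hα, gaussQuantile_gaussCdf]; simp
      · rw [transport, hβ, gaussQuantile_gaussCdf]; simp
    · rw [Ioc_eq_empty_of_le h.le]
      simpa using integral_nonneg fun x => abs_nonneg (q x * transport p x)
  have hnn : ∀ x, 0 ≤ p x * transportSlope p x := fun x =>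
    mul_nonneg (h0 x) (transportSlope_nonneg h0 x)
  set S : Set ℝ := {x | p x ≠ 0}
  have hS : MeasurableSet S := hc.measurable (measurableSet_singleton 0).compl
  have hcover : AECover (volume.restrict S) atTop fun k : ℕ => Ioc (α k) (β k) := by
    refine ⟨(ae_restrict_iff' hS).2 (Eventually.of_forall fun x hx => ?_),
      fun k => measurableSet_Ioc⟩
    have hx' := cdfOf_mem_Ioo hc hi h0 hm ((h0 x).lt_of_ne' hx)
    obtain ⟨y, hy⟩ := exists_gaussCdf_eq hx'
    filter_upwards [(tendsto_natCast_atTop_atTop (R := ℝ)).eventually_gt_atTop |y|] with k hk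
    rw [abs_lt] at hk
    constructor
    · by_contra h
      have := hmono (not_lt.1 h)
      rw [hα, ← hy, strictMono_gaussCdf.le_iff_le] at this
      linarith [hk.1]
    · by_contra h
      have := hmono (not_le.1 h).le
      rw [hβ, ← hy, strictMono_gaussCdf.le_iff_le] at this
      linarith [hk.2]
  have hle : ∀ k, ∫ x in Ioc (α k) (β k), p x * transportSlope p x ∂(volume.restrict S) ≤ D :=
    fun k => (integral_mono_measure (Measure.restrict_mono le_rfl Measure.restrict_le_self)
      (Eventually.of_forall hnn) (key k).1).trans (key k).2
  have hiS : IntegrableOn (fun x => p x * transportSlope p x) S := by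
    refine hcover.integrable_of_integral_bounded_of_nonneg_ae D (fun k => ?_)
      (Eventually.of_forall hnn) (Eventually.of_forall hle)
    exact (key k).1.mono_measure Measure.restrict_le_self
  have hlim := hcover.integral_tendsto_of_countably_generated hiS
  have hzero : ∀ x, x ∉ S → p x * transportSlope p x = 0 := fun x hx => by
    have : p x = 0 := not_not.1 hx
    simp [this]
  have hI : Integrable fun x => p x * transportSlope p x := by
    rwa [← integrableOn_iff_integrable_of_support_subset (s := S)]
    intro x hx
    by_contra h
    exact hx (hzero x h)
  refine ⟨hI, le_trans (mul_le_mul_of_nonneg_left ?_ hs.le) hD⟩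
  rw [← setIntegral_eq_integral_of_forall_compl_eq_zero hzero]
  exact le_of_tendsto' hlim hle

/-- The Monge–Ampère equation and `log x ≤ x - 1` bound the logarithm of the density. -/
lemma log_density_le {p m T s : ℝ} (hp : 0 < p) (hm : 0 < m) (hs : 0 < s) :
    Real.log (p / m) ≤ -T ^ 2 / 2 - 1 / 2 * Real.log (2 * Real.pi)
      + s * (p / (m * gaussDensity T)) - 1 - Real.log s := by
  have hγ := gaussDensity_pos T
  have hS : 0 < p / (m * gaussDensity T) := by positivity
  have e : Real.log (p / m) = Real.log (gaussDensity T) + Real.log (p / (m * gaussDensity T)) := by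
    rw [← Real.log_mul hγ.ne' hS.ne']
    congr 1
    field_simp
  have h := Real.log_le_sub_one_of_pos (mul_pos hs hS)
  rw [Real.log_mul hs.ne' hS.ne'] at h
  rw [e, log_gaussDensity]
  linarith

/-! ### The sharp logarithmic Sobolev inequality along the lines of a product -/

lemma cdfOf_congr_ae {p P : ℝ → ℝ} (h : p =ᵐ[volume] P) : cdfOf p = cdfOf P := by
  funext x
  rw [cdfOf, cdfOf, integral_congr_ae h, integral_congr_ae (ae_restrict_of_ae h)]

lemma transport_congr_ae {p P : ℝ → ℝ} (h : p =ᵐ[volume] P) : transport p = transport P := by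
  funext x
  rw [transport, transport, cdfOf_congr_ae h]

lemma transportSlope_congr_ae {p P : ℝ → ℝ} (h : p =ᵐ[volume] P) {x : ℝ} (hx : p x = P x) :
    transportSlope p x = transportSlope P x := by
  rw [transportSlope, transportSlope, transport_congr_ae h, integral_congr_ae h, hx]

lemma isWeakDeriv_inv_mul {p q : ℝ → ℝ} {c : ℝ} (hc : c ≠ 0)
    (hw : ∀ φ : ℝ → ℝ, ContDiff ℝ ∞ φ → HasCompactSupport φ →
      c * (∫ u, p u * deriv φ u) = -∫ u, q u * φ u) : IsWeakDeriv p fun x => c⁻¹ * q x := by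
  intro φ hφ hs
  simp only [mul_assoc, integral_const_mul]
  rw [← mul_neg, ← hw φ hφ hs, inv_mul_cancel_left₀ hc]

/-- The second moment and the energy bound of the transport map on a line on which the vector field
is `c` times the derivative, `q` is its value on the density `p`, and `q² ≤ 4 p r`. The scale
`|c| √(t / 2)` is the one that makes the resulting logarithmic Sobolev inequality sharp. -/
lemma transport_estimates {p q r : ℝ → ℝ} {c t : ℝ} (hp : Integrable p) (hq : Integrable q)
    (hr : Integrable r) (hp0 : ∀ x, 0 ≤ p x) (hr0 : ∀ x, 0 ≤ r x)
    (hqr : ∀ᵐ x, q x ^ 2 ≤ 4 * (p x * r x)) (hc : c ≠ 0)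
    (hw : ∀ φ : ℝ → ℝ, ContDiff ℝ ∞ φ → HasCompactSupport φ →
      c * (∫ u, p u * deriv φ u) = -∫ u, q u * φ u) (ht : 0 < t) :
    (Integrable (fun x => p x * transport p x ^ 2) ∧
      ∫ x, p x * transport p x ^ 2 = ∫ x, p x) ∧
    Integrable (fun x => p x * transportSlope p x) ∧
      |c| * √(t / 2) * ∫ x, p x * transportSlope p x ≤ t * (∫ x, r x) + 1 / 2 * ∫ x, p x := by
  have hm0 : 0 ≤ ∫ x, p x := integral_nonneg hp0
  rcases hm0.eq_or_lt with hm | hm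
  · have hz : p =ᵐ[volume] 0 := (integral_eq_zero_iff_of_nonneg hp0 hp).1 hm.symm
    have e1 : (fun x => p x * transport p x ^ 2) =ᵐ[volume] 0 := by
      filter_upwards [hz] with x hx
      simp [hx]
    have e2 : (fun x => p x * transportSlope p x) =ᵐ[volume] 0 := by
      filter_upwards [hz] with x hx
      simp [hx]
    have h0 : Integrable (0 : ℝ → ℝ) := integrable_zero _ _ _
    refine ⟨⟨h0.congr e1.symm, ?_⟩, h0.congr e2.symm, ?_⟩
    · rw [integral_congr_ae e1, ← hm]; simp
    · rw [integral_congr_ae e2, ← hm]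
      simpa using mul_nonneg ht.le (integral_nonneg hr0)
  obtain ⟨P, hP, hpP⟩ := (isWeakDeriv_inv_mul hc hw).exists_isPrimitive hp.locallyIntegrable
    (hq.const_mul c⁻¹).locallyIntegrable
  have hpP' : p =ᵐ[volume] P := hpP
  have hPi : Integrable P := hp.congr hpP'
  have hP0 : ∀ x, 0 ≤ P x := by
    have : (fun x => max (P x) 0) = P := by
      refine Measure.eq_of_ae_eq (μ := volume) ?_ (hP.continuous.max continuous_const)
        hP.continuous
      filter_upwards [hpP] with x hx
      rw [← hx, max_eq_left (hp0 x)]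
    intro x
    rw [← this]
    exact le_max_right _ _
  have hPm : 0 < ∫ x, P x := by rwa [← integral_congr_ae hpP']
  have c2 : 0 < c ^ 2 := by positivity
  have hs : 0 < |c| * √(t / 2) := by positivity
  have h1 := integrable_mul_transport_sq hP.continuous hPi hP0 hPm
  have h2 := integrable_mul_transportSlope (r := fun x => (c ^ 2)⁻¹ * r x)
    hP hPi hP0 hPm (hq.const_mul c⁻¹) (hr.const_mul _)
    (Eventually.of_forall fun x => mul_nonneg (inv_nonneg.2 c2.le) (hr0 x)) (by
      filter_upwards [hqr, hpP] with x hx hx'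
      rw [← hx', mul_pow, inv_pow]
      calc (c ^ 2)⁻¹ * q x ^ 2 ≤ (c ^ 2)⁻¹ * (4 * (p x * r x)) := by gcongr
        _ = _ := by ring) hs (mul_pos ht c2)
  have e1 : (fun x => p x * transport p x ^ 2) =ᵐ[volume]
      fun x => P x * transport P x ^ 2 := by
    filter_upwards [hpP] with x hx
    rw [hx, transport_congr_ae hpP']
  have e2 : (fun x => p x * transportSlope p x) =ᵐ[volume]
      fun x => P x * transportSlope P x := by
    filter_upwards [hpP] with x hx
    rw [transportSlope_congr_ae hpP' hx, hx]
  refine ⟨⟨h1.1.congr e1.symm, ?_⟩, h2.1.congr e2.symm, ?_⟩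
  · rw [integral_congr_ae e1, h1.2, integral_congr_ae hpP']
  · rw [integral_congr_ae e2, integral_congr_ae hpP']
    refine h2.2.trans_eq ?_
    rw [integral_const_mul, mul_pow, sq_abs, Real.sq_sqrt (by positivity)]
    field_simp

section Fibre

variable {Ω : Type*} [MeasurableSpace Ω] {ν : Measure Ω}

lemma ae_eq_zero_of_fibre_integral_eq_zero [SFinite ν] {p : Ω × ℝ → ℝ}
    (hp : Integrable p (ν.prod volume))
    (hp0 : ∀ z, 0 ≤ p z) : ∀ᵐ z ∂(ν.prod volume), (∫ u, p (z.1, u)) = 0 → p z = 0 := by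
  obtain ⟨g, hg, hpg⟩ := hp.1
  have hfib : ∀ᵐ y ∂ν, ∀ᵐ u, p (y, u) = g (y, u) := Measure.ae_ae_of_ae_prod hpg
  have hgm : Measurable fun y => ∫ u, g (y, u) := hg.integral_prod_right'.measurable
  have key : ∀ᵐ z ∂(ν.prod volume), (∫ u, g (z.1, u)) = 0 → g z = 0 := by
    have hmeas : MeasurableSet {z : Ω × ℝ | (∫ u, g (z.1, u)) = 0 → g z = 0} := by
      have h1 : MeasurableSet {z : Ω × ℝ | (∫ u, g (z.1, u)) = 0} :=
        (hgm.comp measurable_fst) (measurableSet_singleton 0)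
      have h2 : MeasurableSet {z : Ω × ℝ | g z = 0} :=
        hg.measurable (measurableSet_singleton 0)
      exact h1.himp h2
    refine (Measure.ae_prod_iff_ae_ae hmeas).2 ?_
    filter_upwards [hfib, hp.prod_right_ae] with y h1 h2
    by_cases h : ∫ u, g (y, u) = 0
    · rw [← integral_congr_ae h1, integral_eq_zero_iff_of_nonneg (fun u => hp0 _) h2] at h
      filter_upwards [h, h1] with u h3 h4 _
      rw [← h4]; exact h3
    · exact Eventually.of_forall fun u h' => absurd h' h
  filter_upwards [key, hpg, Measure.quasiMeasurePreserving_fst.ae hfib] with z h1 h2 h3 h4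
  rw [h2]
  exact h1 (by rw [← h4]; exact (integral_congr_ae h3).symm)

lemma aestronglyMeasurable_transport {p : Ω × ℝ → ℝ} (hp : Integrable p (ν.prod volume)) :
    AEStronglyMeasurable (fun z : Ω × ℝ => transport (fun u => p (z.1, u)) z.2)
      (ν.prod volume) := by
  obtain ⟨g, hg, hpg⟩ := hp.1
  have hfib : ∀ᵐ y ∂ν, ∀ᵐ u, p (y, u) = g (y, u) := Measure.ae_ae_of_ae_prod hpg
  refine ⟨fun z => transport (fun u => g (z.1, u)) z.2, ?_, ?_⟩
  · have h1 : Measurable fun z : Ω × ℝ => ∫ u in Iic z.2, g (z.1, u) := by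
      have hs : MeasurableSet {w : (Ω × ℝ) × ℝ | w.2 ≤ w.1.2} :=
        measurableSet_le measurable_snd (measurable_snd.comp measurable_fst)
      have h2 : StronglyMeasurable
          ({w : (Ω × ℝ) × ℝ | w.2 ≤ w.1.2}.indicator fun w => g (w.1.1, w.2)) :=
        (hg.comp_measurable (by fun_prop)).indicator hs
      have e : (fun z : Ω × ℝ => ∫ u in Iic z.2, g (z.1, u)) = fun z : Ω × ℝ => ∫ u : ℝ,
          {w : (Ω × ℝ) × ℝ | w.2 ≤ w.1.2}.indicator (fun w => g (w.1.1, w.2)) (z, u) := by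
        funext z
        rw [← integral_indicator measurableSet_Iic]
        rfl
      rw [e]
      exact (h2.integral_prod_right' (ν := (volume : Measure ℝ))).measurable
    have h2 : Measurable fun z : Ω × ℝ => ∫ u, g (z.1, u) :=
      (hg.integral_prod_right' (ν := (volume : Measure ℝ))).measurable.comp measurable_fst
    exact (measurable_gaussQuantile.comp (h1.div h2)).stronglyMeasurable
  · filter_upwards [Measure.quasiMeasurePreserving_fst.ae hfib] with z hz
    rw [transport_congr_ae hz]

/-- The one-dimensional sharp logarithmic Sobolev inequality along the lines of a product, in the
form of an integrable majorant of the relative entropy density. -/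
lemma exists_fibre_majorant [SFinite ν] {p q r : Ω × ℝ → ℝ} {c : Ω → ℝ} {t : ℝ}
    (hp : Integrable p (ν.prod volume)) (hq : Integrable q (ν.prod volume))
    (hr : Integrable r (ν.prod volume)) (hp0 : ∀ z, 0 ≤ p z) (hr0 : ∀ z, 0 ≤ r z)
    (hqr : ∀ᵐ z ∂(ν.prod volume), q z ^ 2 ≤ 4 * (p z * r z))
    (hcm : AEMeasurable c ν) (hc : ∀ᵐ y ∂ν, c y ≠ 0)
    (hw : ∀ᵐ y ∂ν, ∀ φ : ℝ → ℝ, ContDiff ℝ ∞ φ → HasCompactSupport φ →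
      c y * (∫ u, p (y, u) * deriv φ u) = -∫ u, q (y, u) * φ u) (ht : 0 < t) :
    ∃ b : Ω × ℝ → ℝ, Integrable (fun z => p z * b z) (ν.prod volume) ∧
      (∀ᵐ z ∂(ν.prod volume),
        p z * (Real.log (p z / ∫ u, p (z.1, u)) + 1 / 2 * Real.log (c z.1 ^ 2)) ≤ p z * b z) ∧
      ∫ z, p z * b z ∂(ν.prod volume) ≤ t * (∫ z, r z ∂(ν.prod volume))
        - 1 / 2 * Real.log (Real.pi * Real.exp 1 ^ 2 * t) * ∫ z, p z ∂(ν.prod volume) := by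
  set T : Ω × ℝ → ℝ := fun z => transport (fun u => p (z.1, u)) z.2
  set S : Ω × ℝ → ℝ := fun z => transportSlope (fun u => p (z.1, u)) z.2
  have hTm : AEStronglyMeasurable T (ν.prod volume) := aestronglyMeasurable_transport hp
  have hmm : AEStronglyMeasurable (fun z : Ω × ℝ => ∫ u, p (z.1, u)) (ν.prod volume) :=
    hp.1.integral_prod_right'.comp_fst
  have hSm : AEStronglyMeasurable S (ν.prod volume) := by
    have h1 : AEMeasurable (fun z => gaussDensity (T z)) (ν.prod volume) :=
      measurable_gaussDensity.comp_aemeasurable hTm.aemeasurable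
    exact (hp.1.aemeasurable.div (hmm.aemeasurable.mul h1)).aestronglyMeasurable
  have hcm' : AEStronglyMeasurable (fun z : Ω × ℝ => |c z.1| * √(t / 2)) (ν.prod volume) :=
    ((hcm.comp_quasiMeasurePreserving Measure.quasiMeasurePreserving_fst).abs.mul_const
      _).aestronglyMeasurable
  set A : Ω × ℝ → ℝ := fun z => p z * T z ^ 2
  set E : Ω × ℝ → ℝ := fun z => |c z.1| * √(t / 2) * (p z * S z)
  have hA0 : ∀ z, 0 ≤ A z := fun z => mul_nonneg (hp0 z) (sq_nonneg _)
  have hE0 : ∀ z, 0 ≤ E z := fun z => mul_nonneg (by positivity)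
    (mul_nonneg (hp0 z) (transportSlope_nonneg (fun u => hp0 _) _))
  have hAm : AEStronglyMeasurable A (ν.prod volume) := hp.1.mul (hTm.pow 2)
  have hEm : AEStronglyMeasurable E (ν.prod volume) := hcm'.mul (hp.1.mul hSm)
  have hest : ∀ᵐ y ∂ν, (Integrable (fun u => A (y, u)) ∧
      ∫ u, A (y, u) = ∫ u, p (y, u)) ∧ Integrable (fun u => E (y, u)) ∧
      ∫ u, E (y, u) ≤ t * (∫ u, r (y, u)) + 1 / 2 * ∫ u, p (y, u) := by
    filter_upwards [hp.prod_right_ae, hq.prod_right_ae, hr.prod_right_ae, hc, hw,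
      Measure.ae_ae_of_ae_prod hqr] with y h1 h2 h3 h4 h5 h6
    obtain ⟨g1, g2, g3⟩ := transport_estimates h1 h2 h3 (fun u => hp0 _) (fun u => hr0 _) h6 h4
      h5 ht
    refine ⟨g1, g2.const_mul (|c y| * √(t / 2)), ?_⟩
    simp only [E, S]
    rw [integral_const_mul]
    exact g3
  have hpI : Integrable (fun y => ∫ u, p (y, u)) ν := hp.integral_prod_left
  have hrI : Integrable (fun y => ∫ u, r (y, u)) ν := hr.integral_prod_left
  have hAi : Integrable A (ν.prod volume) := by
    refine (integrable_prod_iff hAm).2 ⟨hest.mono fun y h => h.1.1, hpI.congr ?_⟩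
    filter_upwards [hest] with y h
    rw [← h.1.2]
    exact integral_congr_ae (Eventually.of_forall fun u => (Real.norm_of_nonneg (hA0 _)).symm)
  have hEi : Integrable E (ν.prod volume) := by
    refine (integrable_prod_iff hEm).2 ⟨hest.mono fun y h => h.2.1,
      ((hrI.const_mul t).add (hpI.const_mul (1 / 2))).mono' hEm.norm.integral_prod_right' ?_⟩
    filter_upwards [hest] with y h
    rw [Real.norm_of_nonneg (integral_nonneg fun u => norm_nonneg _)]
    refine le_trans (le_of_eq ?_) h.2.2
    exact integral_congr_ae (Eventually.of_forall fun u => Real.norm_of_nonneg (hE0 _))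
  have hAint : ∫ z, A z ∂(ν.prod volume) = ∫ z, p z ∂(ν.prod volume) := by
    rw [integral_prod _ hAi, integral_prod _ hp]
    exact integral_congr_ae (hest.mono fun y h => h.1.2)
  have hEint : ∫ z, E z ∂(ν.prod volume) ≤
      t * (∫ z, r z ∂(ν.prod volume)) + 1 / 2 * ∫ z, p z ∂(ν.prod volume) := by
    rw [integral_prod _ hEi, integral_prod _ hp, integral_prod _ hr, ← integral_const_mul,
      ← integral_const_mul, ← integral_add (hrI.const_mul t) (hpI.const_mul _)]
    exact integral_mono_ae hEi.integral_prod_left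
      ((hrI.const_mul t).add (hpI.const_mul (1 / 2))) (hest.mono fun y h => h.2.2)
  set K : ℝ := -(1 / 2 * Real.log (2 * Real.pi)) - 1 - 1 / 2 * Real.log (t / 2)
  have hpb : (fun z => p z * (-T z ^ 2 / 2 + |c z.1| * √(t / 2) * S z + K)) =
      fun z => (-1 / 2 * A z + E z) + K * p z := by
    funext z; simp only [A, E]; ring
  refine ⟨fun z => -T z ^ 2 / 2 + |c z.1| * √(t / 2) * S z + K, ?_, ?_, ?_⟩
  · rw [hpb]
    exact ((hAi.const_mul _).add hEi).add (hp.const_mul K)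
  · filter_upwards [ae_eq_zero_of_fibre_integral_eq_zero hp hp0,
      Measure.quasiMeasurePreserving_fst.ae hc] with z h1 h2
    rcases (hp0 z).eq_or_lt with h | h
    · simp [← h]
    have hm : 0 < ∫ u, p (z.1, u) :=
      (integral_nonneg fun u => hp0 _).lt_of_ne' fun h' => h.ne' (h1 h')
    have h2' : 0 < |c z.1| := abs_pos.2 h2
    have ht2 : 0 < √(t / 2) := by positivity
    have hlog := log_density_le (T := T z) h hm (mul_pos h2' ht2)
    refine mul_le_mul_of_nonneg_left ?_ h.le
    rw [Real.log_mul h2'.ne' ht2.ne', Real.log_abs, Real.log_sqrt (by positivity)] at hlog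
    rw [Real.log_pow]
    have e : S z = p z / ((∫ u, p (z.1, u)) * gaussDensity (T z)) := rfl
    rw [← e] at hlog
    simp only [K]
    push_cast
    linarith
  · have i1 : Integrable (fun z => -1 / 2 * A z) (ν.prod volume) := hAi.const_mul _
    have i2 : Integrable (fun z => -1 / 2 * A z + E z) (ν.prod volume) := i1.add hEi
    rw [hpb, integral_add i2 (hp.const_mul K), integral_add i1 hEi, integral_const_mul,
      integral_const_mul, hAint]
    have eK : K = -1 / 2 * Real.log (Real.pi * Real.exp 1 ^ 2 * t) := by
      have hπ := Real.pi_pos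
      simp only [K]
      rw [Real.log_mul (by positivity) ht.ne', Real.log_mul hπ.ne' (by positivity),
        Real.log_pow, Real.log_exp, Real.log_mul two_ne_zero hπ.ne',
        Real.log_div ht.ne' two_ne_zero]
      push_cast
      ring
    rw [eK]
    linarith

end Fibre

/-! ### Induction on the dimension -/

section Coordinates

lemma measurePreserving_insertNth {n : ℕ} (i : Fin (n + 1)) :
    MeasurePreserving (fun z : (Fin n → ℝ) × ℝ => (i.insertNth z.2 z.1 : Fin (n + 1) → ℝ))
      (volume.prod volume) volume :=
  ((volume_preserving_piFinSuccAbove (fun _ : Fin (n + 1) => ℝ) i).symm _).comp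
    Measure.measurePreserving_swap

lemma quasiMeasurePreserving_removeNth {n : ℕ} (i : Fin (n + 1)) :
    Measure.QuasiMeasurePreserving (fun x : Fin (n + 1) → ℝ => i.removeNth x) volume volume :=
  Measure.quasiMeasurePreserving_snd.comp
    (volume_preserving_piFinSuccAbove (fun _ : Fin (n + 1) => ℝ) i).quasiMeasurePreserving

/-- An integrable function of `n` coordinates and a parameter is, for almost every point, integrable
in the `i`-th coordinate and the parameter. -/
lemma ae_integrable_update_prod {n : ℕ} {Ω : Type*} [MeasurableSpace Ω] {ν : Measure Ω}
    [SFinite ν] {F : (Fin n → ℝ) × Ω → ℝ} (hF : Integrable F (volume.prod ν)) (i : Fin n) :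
    ∀ᵐ x : Fin n → ℝ, Integrable (fun z : ℝ × Ω => F (Function.update x i z.1, z.2))
      (volume.prod ν) := by
  obtain _ | n := n
  · exact i.elim0
  have h1 := ((measurePreserving_insertNth i).prod (MeasurePreserving.id ν)).comp
    ((measurePreserving_prodAssoc (volume : Measure (Fin n → ℝ)) (volume : Measure ℝ) ν).symm _)
  have h2 := ((h1.integrable_comp hF.1).2 hF).prod_right_ae
  filter_upwards [(quasiMeasurePreserving_removeNth i).ae h2] with x hx
  simpa [Function.comp_def, MeasurableEquiv.prodAssoc] using hx

lemma ae_integrable_update {n : ℕ} {F : (Fin n → ℝ) → ℝ} (hF : Integrable F) (i : Fin n) :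
    ∀ᵐ x : Fin n → ℝ, Integrable (fun u : ℝ => F (Function.update x i u)) := by
  obtain _ | n := n
  · exact i.elim0
  have h := measurePreserving_insertNth i
  have h2 := ((h.integrable_comp hF.1).2 hF).prod_right_ae
  filter_upwards [(quasiMeasurePreserving_removeNth i).ae h2] with x hx
  simpa [Function.comp_def] using hx

/-- A function whose integral over almost every line parallel to an axis vanishes has integral
zero. -/
lemma integral_eq_zero_of_lines {n : ℕ} {F : (Fin n → ℝ) → ℝ} (hF : Integrable F) (i : Fin n)
    (h0 : ∀ᵐ x : Fin n → ℝ, ∫ u : ℝ, F (Function.update x i u) = 0) : ∫ x, F x = 0 := by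
  obtain _ | n := n
  · exact i.elim0
  have h := measurePreserving_insertNth i
  have h2 := (h.integrable_comp hF.1).2 hF
  rw [← h.map_eq, integral_map h.measurable.aemeasurable (by rw [h.map_eq]; exact hF.1)]
  refine (integral_prod _ h2).trans (integral_eq_zero_of_ae ?_)
  filter_upwards [Measure.ae_ae_of_ae_prod (h.quasiMeasurePreserving.ae h0)] with y hy
  obtain ⟨v, hv⟩ := hy.exists
  simpa using hv

/-- The splitting of the last coordinate. -/
def splitLast (n : ℕ) : (Fin (n + 1) → ℝ) ≃ᵐ (Fin n → ℝ) × ℝ :=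
  (MeasurableEquiv.piFinSuccAbove (fun _ : Fin (n + 1) => ℝ) (Fin.last n)).trans
    MeasurableEquiv.prodComm

lemma measurePreserving_splitLast (n : ℕ) :
    MeasurePreserving (splitLast n) volume (volume.prod volume) :=
  Measure.measurePreserving_swap.comp
    (volume_preserving_piFinSuccAbove (fun _ : Fin (n + 1) => ℝ) (Fin.last n))

lemma splitLast_symm_apply {n : ℕ} (z : (Fin n → ℝ) × ℝ) :
    (splitLast n).symm z = Fin.snoc (α := fun _ => ℝ) z.1 z.2 :=
  Fin.insertNth_last' z.2 z.1

variable {n : ℕ} (ρ : (i : Fin (n + 1)) → (Fin (i : ℕ) → ℝ) → ℝ)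

/-- The coefficients of the vector fields on the first `n` coordinates. -/
def initCoef (i : Fin n) : (Fin (i : ℕ) → ℝ) → ℝ := ρ i.castSucc

/-- The coefficient of the last vector field, as a function of the first `n` coordinates; it
is `1` if there are none. -/
noncomputable def lastCoef (y : Fin n → ℝ) : ℝ := if n = 0 then 1 else ρ (Fin.last n) y

lemma coef_castSucc_snoc (i : Fin n) (y : Fin n → ℝ) (w : ℝ) :
    coef ρ i.castSucc (Fin.snoc (α := fun _ => ℝ) y w) = coef (initCoef ρ) i y := by
  have e : (fun j : Fin (i : ℕ) => Fin.snoc (α := fun _ => ℝ) y w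
      (⟨j, j.isLt.trans i.castSucc.isLt⟩ : Fin (n + 1)))
      = fun j : Fin (i : ℕ) => y ⟨j, j.isLt.trans i.isLt⟩ := by
    funext j
    exact Fin.snoc_castSucc (α := fun _ => ℝ) w y ⟨j, j.isLt.trans i.isLt⟩
  unfold coef initCoef
  exact congrArg (fun v => if (i : ℕ) = 0 then (1 : ℝ) else ρ i.castSucc v) e

lemma coef_last_snoc (y : Fin n → ℝ) (w : ℝ) :
    coef ρ (Fin.last n) (Fin.snoc (α := fun _ => ℝ) y w) = lastCoef ρ y := by
  have e : (fun j : Fin n => Fin.snoc (α := fun _ => ℝ) y w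
      (⟨j, j.isLt.trans (Fin.last n).isLt⟩ : Fin (n + 1))) = y := by
    funext j
    exact Fin.snoc_castSucc (α := fun _ => ℝ) w y j
  unfold coef lastCoef
  exact congrArg (fun v => if n = 0 then (1 : ℝ) else ρ (Fin.last n) v) e

lemma weightN_snoc (y : Fin n → ℝ) (w : ℝ) :
    weightN ρ (Fin.snoc (α := fun _ => ℝ) y w)
      = weightN (initCoef ρ) y + 1 / 2 * Real.log (lastCoef ρ y ^ 2) := by
  unfold weightN
  rw [Fin.sum_univ_castSucc, coef_last_snoc, mul_add]
  simp only [coef_castSucc_snoc]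

variable {ρ}

lemma aemeasurable_lastCoef
    (h : ∀ i : Fin (n + 1), (i : ℕ) ≠ 0 → AEMeasurable (ρ i) volume) :
    AEMeasurable (lastCoef ρ) volume := by
  rcases Nat.eq_zero_or_pos n with hn | hn
  · have : lastCoef ρ = fun _ => 1 := by funext y; simp [lastCoef, hn]
    rw [this]; exact aemeasurable_const
  · have : lastCoef ρ = ρ (Fin.last n) := by funext y; simp [lastCoef, hn.ne']
    rw [this]; exact h (Fin.last n) hn.ne'

lemma ae_lastCoef_ne_zero
    (h : ∀ i : Fin (n + 1), (i : ℕ) ≠ 0 → volume {y : Fin (i : ℕ) → ℝ | ρ i y = 0} = 0) :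
    ∀ᵐ y : Fin n → ℝ, lastCoef ρ y ≠ 0 := by
  rcases Nat.eq_zero_or_pos n with hn | hn
  · exact Eventually.of_forall fun y => by simp [lastCoef, hn]
  · have : lastCoef ρ = ρ (Fin.last n) := by funext y; simp [lastCoef, hn.ne']
    rw [this, ae_iff]
    simpa using h (Fin.last n) hn.ne'

lemma aemeasurable_weightN {n : ℕ} {ρ : (i : Fin n) → (Fin (i : ℕ) → ℝ) → ℝ}
    (h : ∀ i : Fin n, (i : ℕ) ≠ 0 → AEMeasurable (ρ i) volume) :
    AEMeasurable (weightN ρ) volume := by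
  induction n with
  | zero =>
    have : weightN ρ = fun _ => 0 := by funext x; simp [weightN]
    rw [this]; exact aemeasurable_const
  | succ n ih =>
    have h1 : AEMeasurable (weightN (initCoef ρ)) volume := ih fun i hi => h i.castSucc hi
    have h2 : AEMeasurable (fun y => weightN (initCoef ρ) y
        + 1 / 2 * Real.log (lastCoef ρ y ^ 2)) volume :=
      h1.add ((Real.measurable_log.comp_aemeasurable
        ((aemeasurable_lastCoef h).pow_const 2)).const_mul _)
    have h3 := (h2.comp_quasiMeasurePreserving (Measure.quasiMeasurePreserving_fst
      (ν := (volume : Measure ℝ)))).comp_quasiMeasurePreserving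
      (measurePreserving_splitLast n).quasiMeasurePreserving
    refine h3.congr (Eventually.of_forall fun x => ?_)
    obtain ⟨z, rfl⟩ := (splitLast n).symm.surjective x
    simp only [Function.comp_apply, MeasurableEquiv.apply_symm_apply]
    rw [splitLast_symm_apply, weightN_snoc]

end Coordinates

/-- `Y_i p = q` weakly, for integrable `p` and `q` (whose restrictions to almost every line are
integrable automatically). -/
def IsWeakYInt {n : ℕ} (ρ : (i : Fin n) → (Fin (i : ℕ) → ℝ) → ℝ) (i : Fin n)
    (p q : (Fin n → ℝ) → ℝ) : Prop :=
  ∀ᵐ x : Fin n → ℝ, ∀ φ : ℝ → ℝ, ContDiff ℝ ∞ φ → HasCompactSupport φ →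
    coef ρ i x * (∫ u, p (Function.update x i u) * deriv φ u)
      = -∫ u, q (Function.update x i u) * φ u

section Marginal

variable {n : ℕ} {ρ : (i : Fin (n + 1)) → (Fin (i : ℕ) → ℝ) → ℝ}

/-- The integral of `f` over the last coordinate. -/
noncomputable def marginal (f : (Fin (n + 1) → ℝ) → ℝ) (y : Fin n → ℝ) : ℝ :=
  ∫ w, f (Fin.snoc (α := fun _ => ℝ) y w)

lemma integrable_snoc {f : (Fin (n + 1) → ℝ) → ℝ} (hf : Integrable f) :
    Integrable (fun z : (Fin n → ℝ) × ℝ => f (Fin.snoc (α := fun _ => ℝ) z.1 z.2))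
      (volume.prod volume) := by
  simp only [← splitLast_symm_apply]
  exact (((measurePreserving_splitLast n).symm _).integrable_comp hf.1).2 hf

lemma integral_snoc (f : (Fin (n + 1) → ℝ) → ℝ) :
    ∫ z : (Fin n → ℝ) × ℝ, f (Fin.snoc (α := fun _ => ℝ) z.1 z.2) ∂(volume.prod volume)
      = ∫ x, f x := by
  simp only [← splitLast_symm_apply]
  exact ((measurePreserving_splitLast n).symm _).integral_comp' f

lemma ae_snoc {P : (Fin (n + 1) → ℝ) → Prop} (h : ∀ᵐ x, P x) :
    ∀ᵐ z : (Fin n → ℝ) × ℝ ∂(volume.prod volume), P (Fin.snoc (α := fun _ => ℝ) z.1 z.2) := by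
  simp only [← splitLast_symm_apply]
  exact ((measurePreserving_splitLast n).symm _).quasiMeasurePreserving.ae h

lemma integrable_marginal {f : (Fin (n + 1) → ℝ) → ℝ} (hf : Integrable f) :
    Integrable (marginal f) := (integrable_snoc hf).integral_prod_left

lemma integral_marginal {f : (Fin (n + 1) → ℝ) → ℝ} (hf : Integrable f) :
    ∫ y, marginal f y = ∫ x, f x := by
  rw [← integral_snoc, integral_prod _ (integrable_snoc hf)]
  rfl

/-- The Cauchy–Schwarz inequality, as the nonnegativity of a quadratic polynomial. -/
lemma sq_integral_le {p q r : ℝ → ℝ} (hp : Integrable p) (hq : Integrable q) (hr : Integrable r)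
    (hp0 : ∀ x, 0 ≤ p x) (hr0 : ∀ x, 0 ≤ r x) (h : ∀ᵐ x, q x ^ 2 ≤ 4 * (p x * r x)) :
    (∫ x, q x) ^ 2 ≤ 4 * ((∫ x, p x) * ∫ x, r x) := by
  have key : ∀ l : ℝ, 0 ≤ (∫ x, p x) * (l * l) + (∫ x, q x) * l + ∫ x, r x := by
    intro l
    have i1 : Integrable fun x => p x * (l * l) := hp.mul_const _
    have i2 : Integrable fun x => q x * l := hq.mul_const _
    have i3 : Integrable fun x => p x * (l * l) + q x * l := i1.add i2
    rw [← integral_mul_const, ← integral_mul_const, ← integral_add i1 i2, ← integral_add i3 hr]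
    refine integral_nonneg_of_ae ?_
    filter_upwards [h] with x hx
    simp only [Pi.zero_apply]
    rcases (hp0 x).eq_or_lt with h0 | h0
    · have : q x = 0 := by
        rw [← h0] at hx
        exact (pow_eq_zero_iff two_ne_zero).1 (le_antisymm (by simpa using hx) (sq_nonneg _))
      rw [← h0, this]
      simpa using hr0 x
    · have h2 : 0 ≤ 4 * p x * (p x * (l * l) + q x * l + r x) := by
        nlinarith [sq_nonneg (2 * p x * l + q x)]
      exact nonneg_of_mul_nonneg_right h2 (by positivity)
  have := discrim_le_zero key
  rw [discrim] at this
  linarith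

lemma sq_marginal_le {p q r : (Fin (n + 1) → ℝ) → ℝ} (hp : Integrable p) (hq : Integrable q)
    (hr : Integrable r) (hp0 : ∀ x, 0 ≤ p x) (hr0 : ∀ x, 0 ≤ r x)
    (h : ∀ᵐ x, q x ^ 2 ≤ 4 * (p x * r x)) :
    ∀ᵐ y, marginal q y ^ 2 ≤ 4 * (marginal p y * marginal r y) := by
  filter_upwards [(integrable_snoc hp).prod_right_ae, (integrable_snoc hq).prod_right_ae,
    (integrable_snoc hr).prod_right_ae, Measure.ae_ae_of_ae_prod (ae_snoc h)] with y h1 h2 h3 h4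
  exact sq_integral_le h1 h2 h3 (fun _ => hp0 _) (fun _ => hr0 _) h4

/-- Integration over the last coordinate commutes with the other vector fields. -/
lemma IsWeakYInt.marginal {i : Fin n} {p q : (Fin (n + 1) → ℝ) → ℝ} (hp : Integrable p)
    (hq : Integrable q) (h : IsWeakYInt ρ i.castSucc p q) :
    IsWeakYInt (initCoef ρ) i (marginal p) (marginal q) := by
  have swap : ∀ {f : (Fin (n + 1) → ℝ) → ℝ} {y : Fin n → ℝ},
      Integrable (fun z : ℝ × ℝ => f (Fin.snoc (α := fun _ => ℝ) (Function.update y i z.1) z.2))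
        (volume.prod volume) → ∀ ψ : ℝ → ℝ, Continuous ψ → HasCompactSupport ψ →
      ∫ u, Grushin.marginal f (Function.update y i u) * ψ u
        = ∫ w, ∫ u, f (Fin.snoc (α := fun _ => ℝ) (Function.update y i u) w) * ψ u := by
    intro f y hf ψ hψ hs
    obtain ⟨C, hC⟩ := hψ.bounded_above_of_compact_support hs
    have hi : Integrable (fun z : ℝ × ℝ =>
        f (Fin.snoc (α := fun _ => ℝ) (Function.update y i z.1) z.2) * ψ z.1)
        (volume.prod volume) :=
      hf.mul_bdd (c := C) (hψ.comp continuous_fst).aestronglyMeasurable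
        (Eventually.of_forall fun z => hC _)
    rw [← integral_integral_swap hi]
    refine integral_congr_ae (Eventually.of_forall fun u => ?_)
    simp only [Grushin.marginal]
    rw [integral_mul_const]
  filter_upwards [ae_integrable_update_prod (integrable_snoc hp) i,
    ae_integrable_update_prod (integrable_snoc hq) i,
    Measure.ae_ae_of_ae_prod (ae_snoc h)] with y h1 h2 h3
  intro φ hφ hs
  rw [swap h1 _ (hφ.continuous_deriv (by simp)) hs.deriv, swap h2 _ hφ.continuous hs,
    ← integral_const_mul, ← integral_neg]
  refine integral_congr_ae ?_
  filter_upwards [h3] with w hw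
  have := hw φ hφ hs
  simp only [coef_castSucc_snoc, ← Fin.snoc_update] at this
  exact this

/-- On the lines in the last direction, the last vector field is a multiple of the derivative. -/
lemma IsWeakYInt.last {p q : (Fin (n + 1) → ℝ) → ℝ} (h : IsWeakYInt ρ (Fin.last n) p q) :
    ∀ᵐ y : Fin n → ℝ, ∀ φ : ℝ → ℝ, ContDiff ℝ ∞ φ → HasCompactSupport φ →
      lastCoef ρ y * (∫ u, p (Fin.snoc (α := fun _ => ℝ) y u) * deriv φ u)
        = -∫ u, q (Fin.snoc (α := fun _ => ℝ) y u) * φ u := by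
  filter_upwards [Measure.ae_ae_of_ae_prod (ae_snoc h)] with y hy
  obtain ⟨w, hw⟩ := hy.exists
  intro φ hφ hs
  have := hw φ hφ hs
  simp only [coef_last_snoc, Fin.update_snoc_last] at this
  exact this

end Marginal

/-- The sharp logarithmic Sobolev inequality for a density `p` with `Y_i p = q_i` and
`q_i² ≤ 4 p r_i`, in the form of a majorant. The densities with these bounds are stable under
integration over the last coordinate, so that the inequality follows by induction from the chain
rule for the entropy: the conditional density of the last coordinate is treated by the
one-dimensional inequality. -/
theorem exists_majorant (t : ℝ) (ht : 0 < t) (n : ℕ)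
    (ρ : (i : Fin n) → (Fin (i : ℕ) → ℝ) → ℝ)
    (hρ_meas : ∀ i : Fin n, (i : ℕ) ≠ 0 → AEMeasurable (ρ i) volume)
    (hρ_zero : ∀ i : Fin n, (i : ℕ) ≠ 0 → volume {y : Fin (i : ℕ) → ℝ | ρ i y = 0} = 0)
    (p : (Fin n → ℝ) → ℝ) (q r : Fin n → (Fin n → ℝ) → ℝ) (hp : Integrable p)
    (hq : ∀ i, Integrable (q i)) (hr : ∀ i, Integrable (r i)) (hp0 : ∀ x, 0 ≤ p x)
    (hr0 : ∀ i x, 0 ≤ r i x) (hqr : ∀ i, ∀ᵐ x, q i x ^ 2 ≤ 4 * (p x * r i x))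
    (hw : ∀ i, IsWeakYInt ρ i p (q i)) :
    ∃ b : (Fin n → ℝ) → ℝ, Integrable (fun x => p x * b x) ∧
      (∀ᵐ x, p x * (Real.log (p x / ∫ x', p x') + weightN ρ x) ≤ p x * b x) ∧
      ∫ x, p x * b x ≤ t * (∑ i, ∫ x, r i x)
        - (n / 2 : ℝ) * Real.log (Real.pi * Real.exp 1 ^ 2 * t) * ∫ x, p x := by
  induction n with
  | zero =>
    refine ⟨fun _ => 0, by simp, Eventually.of_forall fun x => ?_, by simp⟩
    have e : ∫ x', p x' = p x := by
      rw [volume_pi, Measure.pi_of_empty _ x, integral_dirac]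
    rw [e]
    rcases eq_or_ne (p x) 0 with h | h
    · simp [h]
    · simp [div_self h, weightN]
  | succ n ih =>
    obtain ⟨b₁, hb₁i, hb₁, hb₁le⟩ := ih (initCoef ρ)
      (fun i hi => hρ_meas i.castSucc hi) (fun i hi => hρ_zero i.castSucc hi) (marginal p)
      (fun i => marginal (q i.castSucc)) (fun i => marginal (r i.castSucc))
      (integrable_marginal hp) (fun i => integrable_marginal (hq _))
      (fun i => integrable_marginal (hr _)) (fun y => integral_nonneg fun w => hp0 _)
      (fun i y => integral_nonneg fun w => hr0 _ _)
      (fun i => sq_marginal_le hp (hq _) (hr _) hp0 (hr0 _) (hqr _))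
      (fun i => (hw i.castSucc).marginal hp (hq _))
    have hps := integrable_snoc hp
    obtain ⟨b₂, hb₂i, hb₂, hb₂le⟩ := exists_fibre_majorant (c := lastCoef ρ) hps
      (integrable_snoc (hq (Fin.last n))) (integrable_snoc (hr (Fin.last n)))
      (fun z => hp0 _) (fun z => hr0 _ _) (ae_snoc (hqr (Fin.last n)))
      (aemeasurable_lastCoef hρ_meas) (ae_lastCoef_ne_zero hρ_zero) (hw (Fin.last n)).last ht
    set P : (Fin n → ℝ) × ℝ → ℝ := fun z => p (Fin.snoc (α := fun _ => ℝ) z.1 z.2)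
    have hP0 : ∀ z, 0 ≤ P z := fun z => hp0 _
    have hzero := ae_eq_zero_of_fibre_integral_eq_zero hps hP0
    have hzero' : ∀ᵐ z ∂((volume : Measure (Fin n → ℝ)).prod (volume : Measure ℝ)),
        ∫ x, p x = 0 → P z = 0 := by
      by_cases h : ∫ x, p x = 0
      · filter_upwards [ae_snoc ((integral_eq_zero_iff_of_nonneg hp0 hp).1 h)] with z hz _
        exact hz
      · exact Eventually.of_forall fun z h' => absurd h' h
    have hPb₁i : Integrable (fun z => P z * b₁ z.1) (volume.prod volume) := by
      -- Where the marginal vanishes, `b₁` need not be measurable, but there `P` vanishes as well.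
      have hmeas : AEStronglyMeasurable (fun z => P z * b₁ z.1)
          ((volume : Measure (Fin n → ℝ)).prod (volume : Measure ℝ)) := by
        have h1 : AEMeasurable (fun y => marginal p y * b₁ y * (marginal p y)⁻¹) volume :=
          hb₁i.1.aemeasurable.mul (integrable_marginal hp).1.aemeasurable.inv
        refine (hps.1.mul (h1.comp_quasiMeasurePreserving
          Measure.quasiMeasurePreserving_fst).aestronglyMeasurable).congr ?_
        filter_upwards [hzero] with z hz
        simp only [Pi.mul_apply, Function.comp_apply]
        by_cases h : marginal p z.1 = 0
        · simp [P, show p (Fin.snoc (α := fun _ => ℝ) z.1 z.2) = 0 from hz h]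
        · simp only [P]; field_simp
      refine (integrable_prod_iff hmeas).2 ⟨?_, hb₁i.norm.congr (Eventually.of_forall fun y => ?_)⟩
      · filter_upwards [hps.prod_right_ae] with y hy
        exact hy.mul_const _
      · simp only [norm_mul, integral_mul_const]
        congr 1
        have hm0 : 0 ≤ marginal p y := integral_nonneg fun w => hp0 _
        rw [Real.norm_of_nonneg hm0]
        exact integral_congr_ae (Eventually.of_forall fun w =>
          (Real.norm_of_nonneg (hP0 (y, w))).symm)
    have hPb₁ : ∫ z, P z * b₁ z.1 ∂(volume.prod volume) = ∫ y, marginal p y * b₁ y := by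
      rw [integral_prod _ hPb₁i]
      refine integral_congr_ae (Eventually.of_forall fun y => ?_)
      simp only [integral_mul_const]
      rfl
    have hB : Integrable (fun z => P z * (b₁ z.1 + b₂ z)) (volume.prod volume) := by
      simp only [mul_add]; exact hPb₁i.add hb₂i
    refine ⟨fun x => b₁ (splitLast n x).1 + b₂ (splitLast n x), ?_, ?_, ?_⟩
    · have := ((measurePreserving_splitLast n).integrable_comp hB.1).2 hB
      refine this.congr (Eventually.of_forall fun x => ?_)
      simp only [Function.comp_apply, P, ← splitLast_symm_apply, MeasurableEquiv.symm_apply_apply]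
    · have key : ∀ᵐ z ∂((volume : Measure (Fin n → ℝ)).prod (volume : Measure ℝ)),
          P z * (Real.log (P z / ∫ x', p x')
            + weightN ρ (Fin.snoc (α := fun _ => ℝ) z.1 z.2)) ≤ P z * (b₁ z.1 + b₂ z) := by
        filter_upwards [hb₂, hzero, hzero', Measure.quasiMeasurePreserving_fst.ae hb₁]
          with z h2 h0 h0' h1
        rcases (hP0 z).eq_or_lt with h | h
        · simp [← h]
        have hm : 0 < marginal p z.1 :=
          (integral_nonneg fun u => hp0 _).lt_of_ne' fun h' => h.ne' (h0 h')
        have hM : 0 < ∫ x', p x' :=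
          (integral_nonneg hp0).lt_of_ne' fun h' => h.ne' (h0' h')
        have g1 := le_of_mul_le_mul_left h1 hm
        have g2 := le_of_mul_le_mul_left h2 h
        have e : P z / ∫ x', p x' = (P z / marginal p z.1) * (marginal p z.1 / ∫ x', p x') := by
          field_simp
        rw [integral_marginal hp] at g1
        refine mul_le_mul_of_nonneg_left ?_ h.le
        rw [weightN_snoc, e, Real.log_mul (by positivity) (by positivity)]
        have g2' : Real.log (P z / marginal p z.1) + 1 / 2 * Real.log (lastCoef ρ z.1 ^ 2)
          ≤ b₂ z := g2
        linarith
      filter_upwards [(measurePreserving_splitLast n).quasiMeasurePreserving.ae key] with x hx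
      simpa only [P, ← splitLast_symm_apply, MeasurableEquiv.symm_apply_apply] using hx
    · have e : ∫ x, p x * (b₁ (splitLast n x).1 + b₂ (splitLast n x))
          = ∫ z, P z * (b₁ z.1 + b₂ z) ∂(volume.prod volume) := by
        rw [← (measurePreserving_splitLast n).integral_comp']
        simp only [P, ← splitLast_symm_apply, MeasurableEquiv.symm_apply_apply]
      rw [e]
      simp only [mul_add]
      rw [integral_add hPb₁i hb₂i, hPb₁, Fin.sum_univ_castSucc]
      simp only [integral_marginal hp, integral_marginal (hr _)] at hb₁le
      rw [integral_snoc, integral_snoc] at hb₂le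
      push_cast
      linarith

/-! ### The quadratic form and the operator -/

section Line

variable {f g a b : ℝ → ℝ} {c : ℝ}

lemma ae_eq_zero_of_zero_mul (ha : LocallyIntegrable a)
    (h : ∀ φ : ℝ → ℝ, ContDiff ℝ ∞ φ → HasCompactSupport φ →
      0 * (∫ u, f u * deriv φ u) = -∫ u, a u * φ u) : ∀ᵐ x, a x = 0 := by
  refine ae_eq_zero_of_integral_contDiff_smul_eq_zero ha fun φ hφ hs => ?_
  have := h φ hφ hs
  simp only [smul_eq_mul, mul_comm (φ _)]
  linarith

/-- The product rule for `c` times the weak derivative along a line; where `c = 0`, the derivatives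
vanish. -/
lemma leibniz_line (hf : LocallyIntegrable f) (ha : LocallyIntegrable a)
    (hg : LocallyIntegrable g) (hb : LocallyIntegrable b)
    (h1 : ∀ φ : ℝ → ℝ, ContDiff ℝ ∞ φ → HasCompactSupport φ →
      c * (∫ u, f u * deriv φ u) = -∫ u, a u * φ u)
    (h2 : ∀ φ : ℝ → ℝ, ContDiff ℝ ∞ φ → HasCompactSupport φ →
      c * (∫ u, g u * deriv φ u) = -∫ u, b u * φ u)
    (φ : ℝ → ℝ) (hφ : ContDiff ℝ ∞ φ) (hs : HasCompactSupport φ) :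
    c * (∫ u, f u * g u * deriv φ u) = -∫ u, (a u * g u + f u * b u) * φ u := by
  rcases eq_or_ne c 0 with rfl | hc
  · rw [zero_mul, zero_eq_neg]
    refine integral_eq_zero_of_ae ?_
    filter_upwards [ae_eq_zero_of_zero_mul ha h1, ae_eq_zero_of_zero_mul hb h2] with x h3 h4
    simp [h3, h4]
  · obtain ⟨F, hF, hfF⟩ := (isWeakDeriv_inv_mul hc h1).mul (isWeakDeriv_inv_mul hc h2) hf
      (ha.smul c⁻¹) hg (hb.smul c⁻¹)
    have e : ∫ u, f u * g u * deriv φ u = ∫ u, F u * deriv φ u := by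
      refine integral_congr_ae ?_
      filter_upwards [hfF] with x hx
      rw [hx]
    rw [e, hF.isWeakDeriv φ hφ hs, mul_neg, ← integral_const_mul]
    congr 2
    funext u
    field_simp

lemma integral_eq_zero_of_line (hf : Integrable f) (ha : Integrable a)
    (h : ∀ φ : ℝ → ℝ, ContDiff ℝ ∞ φ → HasCompactSupport φ →
      c * (∫ u, f u * deriv φ u) = -∫ u, a u * φ u) : ∫ u, a u = 0 := by
  rcases eq_or_ne c 0 with rfl | hc
  · exact integral_eq_zero_of_ae (ae_eq_zero_of_zero_mul ha.locallyIntegrable h)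
  · obtain ⟨F, hF, hfF⟩ := (isWeakDeriv_inv_mul hc h).exists_isPrimitive hf.locallyIntegrable
      (ha.const_mul c⁻¹).locallyIntegrable
    have := hF.integral_eq_zero (hf.congr hfF) (ha.const_mul c⁻¹)
    rw [integral_const_mul] at this
    exact (mul_eq_zero.1 this).resolve_left (inv_ne_zero hc)

end Line

section Gradient

variable {n : ℕ} {ρ : (i : Fin n) → (Fin (i : ℕ) → ℝ) → ℝ} {f : (Fin n → ℝ) → ℝ}
  {G : Fin n → (Fin n → ℝ) → ℝ}

lemma IsWeakY.leibniz {i : Fin n} {f g a b : (Fin n → ℝ) → ℝ} (h1 : IsWeakY ρ i f a)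
    (h2 : IsWeakY ρ i g b) :
    IsWeakYInt ρ i (fun x => f x * g x) fun x => a x * g x + f x * b x := by
  filter_upwards [h1, h2] with x ⟨f1, f2, f3⟩ ⟨g1, g2, g3⟩
  exact leibniz_line f1 f2 g1 g2 f3 g3

/-- The integration by parts formula for `Y_i`: a product and its `Y_i`-derivative being integrable,
the integral of the latter vanishes. -/
lemma IsWeakYInt.integral_eq_zero {i : Fin n} {p q : (Fin n → ℝ) → ℝ} (h : IsWeakYInt ρ i p q)
    (hp : Integrable p) (hq : Integrable q) : ∫ x, q x = 0 := by
  refine integral_eq_zero_of_lines hq i ?_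
  filter_upwards [h, ae_integrable_update hp i, ae_integrable_update hq i] with x h1 h2 h3
  exact integral_eq_zero_of_line h2 h3 h1

/-- The density `f²` has `Y_i f² = 2 f Y_i f`, whose square is `4 f² (Y_i f)²`, so that
`exists_majorant` applies with `r_i = (Y_i f)²`. -/
lemma HasGradient.exists_majorant (hf : HasGradient ρ f G)
    (hρ_meas : ∀ i : Fin n, (i : ℕ) ≠ 0 → AEMeasurable (ρ i) volume)
    (hρ_zero : ∀ i : Fin n, (i : ℕ) ≠ 0 → volume {y : Fin (i : ℕ) → ℝ | ρ i y = 0} = 0)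
    {t : ℝ} (ht : 0 < t) :
    ∃ B : (Fin n → ℝ) → ℝ, Integrable B ∧
      (∀ᵐ x, entDensity f x + weightN ρ x * f x ^ 2 ≤ B x) ∧
      ∫ x, B x ≤ t * (∫ x, ∑ i, G i x ^ 2)
        - (n / 2 : ℝ) * Real.log (Real.pi * Real.exp 1 ^ 2 * t) * normSq f := by
  have hf2 : Integrable fun x => f x ^ 2 := hf.1.integrable_sq
  have hfG : ∀ i, Integrable fun x => G i x * f x + f x * G i x := fun i =>
    ((hf.2 i).1.integrable_mul hf.1).add (hf.1.integrable_mul (hf.2 i).1)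
  obtain ⟨b, h1, h2, h3⟩ := Grushin.exists_majorant t ht n ρ hρ_meas hρ_zero (fun x => f x ^ 2)
    (fun i x => G i x * f x + f x * G i x) (fun i x => G i x ^ 2) hf2 hfG
    (fun i => (hf.2 i).1.integrable_sq) (fun x => sq_nonneg _) (fun i x => sq_nonneg _)
    (fun i => Eventually.of_forall fun x => le_of_eq (by ring))
    (fun i => by simpa only [sq] using (hf.2 i).2.leibniz (hf.2 i).2)
  refine ⟨_, h1, ?_, ?_⟩
  · filter_upwards [h2] with x hx
    refine le_trans (le_of_eq ?_) hx
    unfold entDensity normSq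
    ring
  · rw [integral_finsetSum _ fun i _ => (hf.2 i).1.integrable_sq]
    exact h3

/-- The integration by parts `∫ (Y_i (Y_i f)) f = - ∫ (Y_i f)²`. -/
lemma HasGradient.integral_mul_eq_neg (hf : HasGradient ρ f G) {i : Fin n}
    {K : (Fin n → ℝ) → ℝ} (hK : IsWeakY ρ i (G i) K) (hKf : Integrable fun x => K x * f x) :
    ∫ x, K x * f x = -∫ x, G i x ^ 2 := by
  have hG2 : Integrable fun x => G i x ^ 2 := (hf.2 i).1.integrable_sq
  have hs : Integrable fun x => G i x * G i x + f x * K x := by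
    have h0 : Integrable fun x => G i x ^ 2 + K x * f x := hG2.add hKf
    simpa only [← sq, mul_comm (f _)] using h0
  have h := ((hf.2 i).2.leibniz hK).integral_eq_zero (hf.1.integrable_mul (hf.2 i).1) hs
  simp only [← sq, mul_comm (f _)] at h
  rw [integral_add hG2 hKf] at h
  linarith

lemma IsNegSumSq.exists_gradient {g : (Fin n → ℝ) → ℝ} (h : IsNegSumSq ρ f g) :
    ∃ G, HasGradient ρ f G ∧ Integrable (fun x => g x * f x) ∧
      ∫ x, ∑ i, G i x ^ 2 = ∫ x, g x * f x := by
  obtain ⟨G, K, hf, hK, hg⟩ := h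
  have e : (fun x => g x * f x) =ᵐ[volume] fun x => -∑ i, K i x * f x := by
    filter_upwards [hg] with x hx
    rw [hx, neg_mul, Finset.sum_mul]
  refine ⟨G, hf, ((integrable_finsetSum _ fun i _ => (hK i).2).neg).congr e.symm, ?_⟩
  rw [integral_congr_ae e, integral_neg, integral_finsetSum _ fun i _ => (hK i).2,
    integral_finsetSum _ fun i _ => (hf.2 i).1.integrable_sq, ← Finset.sum_neg_distrib]
  exact Finset.sum_congr rfl fun i _ => by rw [hf.integral_mul_eq_neg (hK i).1 (hK i).2, neg_neg]

lemma IsGenerator.exists_gradient {g : (Fin n → ℝ) → ℝ} (h : IsGenerator ρ f g) :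
    ∃ G, HasGradient ρ f G ∧ Integrable (fun x => g x * f x) ∧
      ∫ x, ∑ i, G i x ^ 2 = ∫ x, g x * f x := by
  obtain ⟨hg, G, hf, hφ⟩ := h
  exact ⟨G, hf, hg.integrable_mul hf.1, by simpa only [sq] using hφ f G hf⟩

end Gradient

end Grushin

theorem mainTheorem7 (n : ℕ) (hn : 1 ≤ n)
    (ρ : (i : Fin n) → (Fin (i : ℕ) → ℝ) → ℝ)
    (hρ_meas : ∀ i : Fin n, (i : ℕ) ≠ 0 → AEMeasurable (ρ i) volume)
    (hρ_zero : ∀ i : Fin n, (i : ℕ) ≠ 0 → volume {y : Fin (i : ℕ) → ℝ | ρ i y = 0} = 0)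
    (f : (Fin n → ℝ) → ℝ) (G : Fin n → (Fin n → ℝ) → ℝ)
    (hf : Grushin.HasGradient ρ f G)
    (hEnt : Integrable (fun x => max (-Grushin.entDensity f x) 0) volume)
    (hN : Integrable (fun x => max (-(Grushin.weightN ρ x * f x ^ 2)) 0) volume) :
    Integrable (Grushin.entDensity f) volume ∧
    Integrable (fun x => Grushin.weightN ρ x * f x ^ 2) volume ∧
    (∀ t : ℝ, 0 < t →
      (∫ x, Grushin.entDensity f x) ≤
        t * (∫ x, ∑ i, G i x ^ 2)
          - (n / 2 : ℝ) * Real.log (Real.pi * Real.exp 1 ^ 2 * t) * Grushin.normSq f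
          - (∫ x, Grushin.weightN ρ x * f x ^ 2)) ∧
    (∀ g : (Fin n → ℝ) → ℝ, Grushin.IsNegSumSq ρ f g ∨ Grushin.IsGenerator ρ f g →
      Integrable (fun x => g x * f x) volume ∧
      ∀ t : ℝ, 0 < t →
        (∫ x, Grushin.entDensity f x) ≤
          t * (∫ x, g x * f x)
            - (n / 2 : ℝ) * Real.log (Real.pi * Real.exp 1 ^ 2 * t) * Grushin.normSq f
            - (∫ x, Grushin.weightN ρ x * f x ^ 2)) := by
  have hf2 : AEMeasurable (fun x => f x ^ 2) volume := hf.1.1.aemeasurable.pow_const 2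
  have hEm : AEStronglyMeasurable (Grushin.entDensity f) volume :=
    (hf2.mul (Real.measurable_log.comp_aemeasurable
      (hf2.div_const (Grushin.normSq f)))).aestronglyMeasurable
  have hNm : AEStronglyMeasurable (fun x => Grushin.weightN ρ x * f x ^ 2) volume :=
    ((Grushin.aemeasurable_weightN hρ_meas).mul hf2).aestronglyMeasurable
  -- The negative parts and the majorant of the sum bound both functions.
  obtain ⟨B, hB, hle, -⟩ := hf.exists_majorant hρ_meas hρ_zero one_pos
  have hmaj := (hB.abs.add hEnt).add hN
  have hE : Integrable (Grushin.entDensity f) := by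
    refine hmaj.mono' hEm ?_
    filter_upwards [hle] with x hx
    simp only [Pi.add_apply, Real.norm_eq_abs, abs_le]
    have h1 := le_abs_self (B x)
    have h2 := abs_nonneg (B x)
    constructor <;> grind
  have hNi : Integrable (fun x => Grushin.weightN ρ x * f x ^ 2) := by
    refine hmaj.mono' hNm ?_
    filter_upwards [hle] with x hx
    simp only [Pi.add_apply, Real.norm_eq_abs, abs_le]
    have h1 := le_abs_self (B x)
    have h2 := abs_nonneg (B x)
    constructor <;> grind
  have main : ∀ H : Fin n → (Fin n → ℝ) → ℝ, Grushin.HasGradient ρ f H → ∀ t : ℝ, 0 < t →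
      (∫ x, Grushin.entDensity f x) ≤ t * (∫ x, ∑ i, H i x ^ 2)
        - (n / 2 : ℝ) * Real.log (Real.pi * Real.exp 1 ^ 2 * t) * Grushin.normSq f
        - (∫ x, Grushin.weightN ρ x * f x ^ 2) := by
    intro H hH t ht
    obtain ⟨B, hB, hle, hBle⟩ := hH.exists_majorant hρ_meas hρ_zero ht
    have := integral_mono_ae (hE.add hNi) hB hle
    simp only [Pi.add_apply] at this
    rw [integral_add hE hNi] at this
    linarith
  refine ⟨hE, hNi, main G hf, fun g hg => ?_⟩
  obtain ⟨H, hH, hgf, e⟩ := hg.elim Grushin.IsNegSumSq.exists_gradient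
    Grushin.IsGenerator.exists_gradient
  exact ⟨hgf, fun t ht => e ▸ main H hH t ht⟩
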